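/- Let $k$ be a field. A \emph{gentle quiver with relations} $\overline{Q}=(Q,R)$ consists of a quiver $Q$ with finitely many vertices, with at most two arrows leaving and at most two arrows arriving at each vertex, and a set $R$ of paths of length $2$ in $Q$ such that for every arrow $\beta$ there is at most one arrow $\gamma$ with $\beta\gamma$ a path in $R$, at most one arrow $\gamma$ with $\beta\gamma$ a path not in $R$, at most one arrow $\alpha$ with $\alpha\beta$ a path in $R$, and at most one arrow $\alpha$ with $\alpha\beta$ a path not in $R$, and such that all sufficiently long paths of $Q$ contain a subpath in $R$. Its algebra $\Lambda=kQ/\langle R\rangle$ is then finite-dimensional; write $e_i\in\Lambda$ for the idempotent of the vertex $i$. For a ring $A$, let $K^b(\operatorname{proj}A)$ be the bounded homotopy category of finitely generated projective right $A$-modules. A $2$-term object is a complex $P_1\to P_0$ concentrated in homological degrees $1$ and $0$; an object $P$ is rigid if $\operatorname{Hom}_{K^b(\operatorname{proj}A)}(P,P[1])=0$. The $2$-term silting complex $\mathcal{SC}(A)$ is the simplicial complex whose vertices are the isomorphism classes of indecomposable rigid $2$-term objects of $K^b(\operatorname{proj}A)$ and whose faces are the finite sets of such objects whose direct sum is rigid.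 The $\mathbf g$-vector of a $2$-term object is its class in the Grothendieck group $K_0(K^b(\operatorname{proj}A))$. For a quiver with relations, $\mathcal{SC}(\overline{Q}):=\mathcal{SC}(kQ/\langle R\rangle)$. Let $\overline{Q}=(Q,R)$ be a gentle quiver with relations and let $J$ be any subset of its vertices. The \emph{shortcut quiver} $\overline{Q}_J=(Q_J,R_J)$ has the elements of $J$ as vertices; its arrows from $i$ to $j$ are the paths of positive length from $i$ to $j$ in $Q$ which contain no subpath in $R$ and have no interior vertex in $J$; the composition of two consecutive arrows of $Q_J$ is in $R_J$ if and only if the corresponding concatenated path of $Q$ contains a subpath in $R$. \textbf{Theorem.} For every gentle quiver with relations $\overline{Q}$ and every subset $J$ of its vertices, the simplicial complex $\mathcal{SC}(\overline{Q}_J)$ is isomorphic to the subcomplex of $\mathcal{SC}(\overline{Q})$ induced by those vertices (isomorphism classes of indecomposable rigid $2$-term objects) whose $\mathbf g$-vectors lie in the coordinate subspace of $K_0(K^b(\operatorname{proj}\Lambda))$ spanned by the classes of the modules $e_j\Lambda$, $j\in J$, concentrated in degree $0$. -/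

import Mathlib

universe u

noncomputable section

namespace GentleSilting

open CategoryTheory CategoryTheory.Limits CategoryTheory.Pretriangulated ZeroObject

/-! ### Quivers with quadratic monomial relations and their algebras -/

section Quivers

variable {V : Type u} [Quiver.{u} V]

/-- A set of paths of length two in the quiver `V`, given by the pairs `(a, b)` of composable arrows
(first `a`, then `b`) whose composition is a relation. -/
abbrev QuadraticRelations (V : Type u) [Quiver.{u} V] : Type u :=
  ∀ ⦃i j l : V⦄, (i ⟶ j) → (j ⟶ l) → Prop

/-- The path `p` contains no relation as a subpath, i.e. `p` is nonzero in the bound path algebra: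
it is a path of the quiver with relations. -/
def AvoidsRelations (R : QuadraticRelations V) {i j : V} (p : Quiver.Path i j) : Prop :=
  ∀ ⦃x y z : V⦄ (p₁ : Quiver.Path i x) (a : x ⟶ y) (b : y ⟶ z) (p₂ : Quiver.Path z j),
    p = ((p₁.cons a).cons b).comp p₂ → ¬ R a b

/-- Gentle quivers with relations (on a finite set of vertices). -/
structure IsGentle (R : QuadraticRelations V) : Prop where
  /-- at most two arrows leave each vertex -/
  card_out_le : ∀ i : V, ENat.card (Σ j : V, i ⟶ j) ≤ 2
  /-- at most two arrows arrive at each vertex -/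
  card_in_le : ∀ j : V, ENat.card (Σ i : V, i ⟶ j) ≤ 2
  /-- for each arrow `a` there is at most one arrow `b` such that `ab` is a relation -/
  rel_right : ∀ ⦃i j : V⦄ (a : i ⟶ j), {b : Σ l : V, j ⟶ l | R a b.2}.Subsingleton
  /-- for each arrow `a` there is at most one arrow `b` such that `ab` is a path but no relation -/
  not_rel_right : ∀ ⦃i j : V⦄ (a : i ⟶ j), {b : Σ l : V, j ⟶ l | ¬ R a b.2}.Subsingleton
  /-- for each arrow `b` there is at most one arrow `a` such that `ab` is a relation -/
  rel_left : ∀ ⦃j l : V⦄ (b : j ⟶ l), {a : Σ i : V, i ⟶ j | R a.2 b}.Subsingleton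
  /-- for each arrow `b` there is at most one arrow `a` such that `ab` is a path but no relation -/
  not_rel_left : ∀ ⦃j l : V⦄ (b : j ⟶ l), {a : Σ i : V, i ⟶ j | ¬ R a.2 b}.Subsingleton
  /-- all long enough paths contain a relation, i.e. the bound path algebra is
  finite-dimensional -/
  admissible : ∃ N : ℕ, ∀ ⦃i j : V⦄ (p : Quiver.Path i j), AvoidsRelations R p → p.length < N

/-- No vertex of the path `p`, except possibly its two ends, lies in `J`. -/
def NoInteriorVertexIn (J : Finset V) {i j : V} (p : Quiver.Path i j) : Prop :=
  ∀ ⦃x : V⦄ (p₁ : Quiver.Path i x) (p₂ : Quiver.Path x j),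
    p = p₁.comp p₂ → 0 < p₁.length → 0 < p₂.length → x ∉ J

/-- The vertices of the shortcut quiver of `(V, R)` at `J`: the elements of `J`. -/
def Shortcut (_R : QuadraticRelations V) (J : Finset V) : Type u := {i : V // i ∈ J}

instance (R : QuadraticRelations V) (J : Finset V) : Fintype (Shortcut R J) :=
  inferInstanceAs (Fintype {i : V // i ∈ J})

instance [DecidableEq V] (R : QuadraticRelations V) (J : Finset V) : DecidableEq (Shortcut R J) :=
  inferInstanceAs (DecidableEq {i : V // i ∈ J})

/-- The arrows of the shortcut quiver are the paths of positive length in the quiver with relations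
`(V, R)` whose ends are in `J` and which have no interior vertex in `J`. -/
instance (R : QuadraticRelations V) (J : Finset V) : Quiver.{u} (Shortcut R J) where
  Hom i j := {p : Quiver.Path i.1 j.1 //
    0 < p.length ∧ AvoidsRelations R p ∧ NoInteriorVertexIn J p}

/-- The relations of the shortcut quiver are inherited from those of `(V, R)`: the composition of
two arrows is a relation if and only if the concatenated path contains a relation. -/
def shortcutRelations (R : QuadraticRelations V) (J : Finset V) :
    QuadraticRelations (Shortcut R J) :=
  fun _ _ _ p q => ¬ AvoidsRelations R (p.1.comp q.1)

end Quivers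

section PathAlgebra

variable (k : Type u) [Field k] (V : Type u) [Quiver.{u} V]

/-- The path algebra of a finite quiver: an element is a finite linear combination of paths, recorded
by its parts from `i` to `j` for all pairs of vertices `i`, `j`. -/
def PathAlgebra : Type u := ∀ i j : V, Quiver.Path i j →₀ k

instance : AddCommGroup (PathAlgebra k V) :=
  inferInstanceAs (AddCommGroup (∀ i j : V, Quiver.Path i j →₀ k))

variable {V}

/-- Bilinear extension of the concatenation of paths. -/
def concat (i l j : V) :
    (Quiver.Path i l →₀ k) →ₗ[k] (Quiver.Path l j →₀ k) →ₗ[k] (Quiver.Path i j →₀ k) :=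
  Finsupp.linearCombination k
    (fun p : Quiver.Path i l => Finsupp.lmapDomain k k (fun q : Quiver.Path l j => p.comp q))

lemma concat_single {i l j : V} (p : Quiver.Path i l) (q : Quiver.Path l j) (a b : k) :
    concat k i l j (Finsupp.single p a) (Finsupp.single q b) =
      Finsupp.single (p.comp q) (a * b) := by
  simp [concat, Finsupp.linearCombination_single]

lemma concat_assoc {i l m j : V} (f : Quiver.Path i l →₀ k) (g : Quiver.Path l m →₀ k)
    (h : Quiver.Path m j →₀ k) :
    concat k i m j (concat k i l m f g) h = concat k i l j f (concat k l m j g h) := by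
  induction f using Finsupp.induction_linear with
  | zero => simp
  | add f f' hf hf' => simp only [map_add, LinearMap.add_apply, hf, hf']
  | single p a =>
    induction g using Finsupp.induction_linear with
    | zero => simp
    | add g g' hg hg' => simp only [map_add, LinearMap.add_apply, hg, hg']
    | single q b =>
      induction h using Finsupp.induction_linear with
      | zero => simp
      | add h h' hh hh' => simp only [map_add, hh, hh']
      | single r c =>
        simp only [concat_single, mul_assoc, Quiver.Path.comp_assoc]

lemma concat_nil_left {i j : V} (f : Quiver.Path i j →₀ k) :
    concat k i i j (Finsupp.single Quiver.Path.nil 1) f = f := by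
  induction f using Finsupp.induction_linear with
  | zero => simp
  | add f g hf hg => simp only [map_add, hf, hg]
  | single p a => simp [concat_single]

lemma concat_nil_right {i j : V} (f : Quiver.Path i j →₀ k) :
    concat k i j j f (Finsupp.single Quiver.Path.nil 1) = f := by
  induction f using Finsupp.induction_linear with
  | zero => simp
  | add f g hf hg => simp only [map_add, LinearMap.add_apply, hf, hg]
  | single p a => simp [concat_single]

variable [DecidableEq V]

/-- A path, as an element of the path algebra. -/
def ofPath {i j : V} (p : Quiver.Path i j) : PathAlgebra k V :=
  Pi.single (M := fun i => ∀ j : V, Quiver.Path i j →₀ k) i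
    (Pi.single (M := fun j => Quiver.Path i j →₀ k) j (Finsupp.single p 1))

variable [Fintype V]

/-- The product of two paths is their concatenation (first the left factor, then the right factor)
if they can be concatenated and `0` otherwise; the unit is the sum of the paths of length `0`. -/
instance : Ring (PathAlgebra k V) where
  __ := (inferInstance : AddCommGroup (PathAlgebra k V))
  mul f g := fun i j => ∑ l : V, concat k i l j (f i l) (g l j)
  one := fun i => Pi.single (M := fun j => Quiver.Path i j →₀ k) i
    (Finsupp.single Quiver.Path.nil 1)
  left_distrib f g h := by
    funext i j
    change ∑ l : V, concat k i l j (f i l) (g l j + h l j) =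
      ∑ l : V, concat k i l j (f i l) (g l j) + ∑ l : V, concat k i l j (f i l) (h l j)
    simp only [map_add, Finset.sum_add_distrib]
  right_distrib f g h := by
    funext i j
    change ∑ l : V, concat k i l j (f i l + g i l) (h l j) =
      ∑ l : V, concat k i l j (f i l) (h l j) + ∑ l : V, concat k i l j (g i l) (h l j)
    simp only [map_add, LinearMap.add_apply, Finset.sum_add_distrib]
  zero_mul f := by
    funext i j
    change ∑ l : V, concat k i l j 0 (f l j) = 0
    simp
  mul_zero f := by
    funext i j
    change ∑ l : V, concat k i l j (f i l) 0 = 0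
    simp
  mul_assoc f g h := by
    funext i j
    change ∑ m : V, concat k i m j (∑ l : V, concat k i l m (f i l) (g l m)) (h m j) =
      ∑ l : V, concat k i l j (f i l) (∑ m : V, concat k l m j (g l m) (h m j))
    simp only [map_sum, LinearMap.sum_apply, concat_assoc]
    exact Finset.sum_comm
  one_mul f := by
    funext i j
    change ∑ l : V, concat k i l j (Pi.single (M := fun j => Quiver.Path i j →₀ k) i
      (Finsupp.single Quiver.Path.nil 1) l) (f l j) = f i j
    rw [Finset.sum_eq_single i]
    · rw [Pi.single_eq_same, concat_nil_left]
    · intro l _ hl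
      rw [Pi.single_eq_of_ne hl]
      simp
    · simp
  mul_one f := by
    funext i j
    change ∑ l : V, concat k i l j (f i l) (Pi.single (M := fun j => Quiver.Path l j →₀ k) l
      (Finsupp.single Quiver.Path.nil 1) j) = f i j
    rw [Finset.sum_eq_single j]
    · rw [Pi.single_eq_same, concat_nil_right]
    · intro l _ hl
      rw [Pi.single_eq_of_ne (Ne.symm hl)]
      simp
    · simp

lemma ofPath_nil_mul_self (i : V) :
    ofPath k (Quiver.Path.nil : Quiver.Path i i) * ofPath k (Quiver.Path.nil : Quiver.Path i i) =
      ofPath k (Quiver.Path.nil : Quiver.Path i i) := by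
  funext x y
  change ∑ l : V, concat k x l y (ofPath k (Quiver.Path.nil : Quiver.Path i i) x l)
    (ofPath k (Quiver.Path.nil : Quiver.Path i i) l y) =
      ofPath k (Quiver.Path.nil : Quiver.Path i i) x y
  by_cases hx : x = i
  · subst hx
    rw [Finset.sum_eq_single x]
    · simp only [ofPath, Pi.single_eq_same]
      rw [concat_nil_left]
    · intro l _ hl
      simp only [ofPath, Pi.single_eq_same, Pi.single_eq_of_ne hl]
      simp
    · simp
  · simp [ofPath, Pi.single_eq_of_ne hx]

/-- The two-sided ideal of the path algebra generated by the relations. -/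
def relationIdeal (R : QuadraticRelations V) : TwoSidedIdeal (PathAlgebra k V) :=
  TwoSidedIdeal.span
    {x | ∃ (i j l : V) (a : i ⟶ j) (b : j ⟶ l), R a b ∧ x = ofPath k (a.toPath.comp b.toPath)}

/-- The algebra of a quiver with relations: the quotient of its path algebra by the ideal generated
by the relations. -/
abbrev BoundAlgebra (R : QuadraticRelations V) : Type u :=
  (relationIdeal k R).ringCon.Quotient

/-- The idempotent of the vertex `i`. -/
def vertexIdempotent (R : QuadraticRelations V) (i : V) : BoundAlgebra k R :=
  (relationIdeal k R).ringCon.mk' (ofPath k (Quiver.Path.nil : Quiver.Path i i))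

lemma isIdempotentElem_vertexIdempotent (R : QuadraticRelations V) (i : V) :
    IsIdempotentElem (vertexIdempotent k R i) := by
  rw [IsIdempotentElem, vertexIdempotent, ← map_mul, ofPath_nil_mul_self]

end PathAlgebra

/-! ### Bounded homotopy categories and Grothendieck groups -/

section Bounded

variable (C : Type*) [Category* C] [Preadditive C]

/-- The bounded complexes. -/
def bounded : ObjectProperty (HomotopyCategory C (.up ℤ)) :=
  fun X => ∃ a b : ℤ, ∀ n : ℤ, (n < a ∨ b < n) → IsZero (X.as.X n)

variable [HasZeroObject C]

instance : (bounded C).ContainsZero where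
  exists_zero :=
    ⟨(HomotopyCategory.quotient _ _).obj 0, Functor.map_isZero _ (isZero_zero _),
      0, 0, fun n _ => (HomologicalComplex.eval C (.up ℤ) n).map_isZero (isZero_zero _)⟩

instance : (bounded C).IsStableUnderShift ℤ where
  isStableUnderShiftBy n :=
    { le_shift := by
        rintro K ⟨a, b, h⟩
        obtain ⟨K : CochainComplex _ _, rfl⟩ := K.quotient_obj_surjective
        rw [ObjectProperty.prop_shift_iff, HomotopyCategory.shift_quotient_obj]
        exact ⟨a - n, b - n, fun m hm => h (m + n) (by omega)⟩ }

variable [HasBinaryBiproducts C]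

set_option maxHeartbeats 400000 in
instance : (bounded C).IsTriangulatedClosed₃ where
  ext₃' T hT h₁ h₂ := by
    obtain ⟨a₁, b₁, h₁⟩ := h₁
    obtain ⟨a₂, b₂, h₂⟩ := h₂
    obtain ⟨f : T.obj₁.as ⟶ T.obj₂.as, hf⟩ :=
      (HomotopyCategory.quotient C (.up ℤ)).map_surjective T.mor₁
    refine ⟨(HomotopyCategory.quotient C (.up ℤ)).obj (CochainComplex.mappingCone f), ?_,
      ⟨Triangle.π₃.mapIso (isoTriangleOfIso₁₂ T _ hT
        (HomotopyCategory.mappingCone_triangleh_distinguished f)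
        (Iso.refl _) (Iso.refl _) ?_)⟩⟩
    · refine ⟨min (a₁ - 1) a₂, max b₁ b₂, fun n hn => ?_⟩
      exact (CochainComplex.mappingCone.isZero_X_iff f n).2
        ⟨h₁ (n + 1) (by omega), h₂ n (by omega)⟩
    · exact (Category.comp_id _).trans (hf.symm.trans (Category.id_comp _).symm)

instance : (bounded C).IsTriangulated where
  toIsTriangulatedClosed₂ := .of_isTriangulatedClosed₃

/-- The homotopy category of bounded complexes in an additive category. -/
abbrev BoundedHomotopyCategory := (bounded C).FullSubcategory

variable {C}

/-- An object of `C`, as a complex concentrated in degree `0`. -/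
def inDegreeZero (X : C) : BoundedHomotopyCategory C where
  obj := (HomotopyCategory.quotient C (.up ℤ)).obj ((HomologicalComplex.single C (.up ℤ) 0).obj X)
  property := ⟨0, 0, fun n hn =>
    HomologicalComplex.isZero_single_obj_X (.up ℤ) 0 X n (by omega)⟩

/-- The objects of the form `P₁ ⟶ P₀`. In cohomological numbering, `P₁` stands in degree `-1` and
`P₀` in degree `0`. -/
def IsTwoTerm (X : BoundedHomotopyCategory C) : Prop :=
  ∀ n : ℤ, n ≠ -1 → n ≠ 0 → IsZero (X.obj.as.X n)

end Bounded

section Triangulated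

variable (T : Type*) [Category* T] [Preadditive T] [HasZeroObject T] [HasShift T ℤ]
  [∀ n : ℤ, (shiftFunctor T n).Additive] [Pretriangulated T]

/-- The Grothendieck group of a triangulated category: generators are the objects, and each
distinguished triangle `X ⟶ Y ⟶ Z ⟶ X[1]` gives a relation `[Y] = [X] + [Z]`. -/
def K0 : Type _ :=
  FreeAbelianGroup T ⧸ AddSubgroup.closure
    {x : FreeAbelianGroup T | ∃ Δ ∈ distTriang T,
      x = FreeAbelianGroup.of Δ.obj₂ - (FreeAbelianGroup.of Δ.obj₁ + FreeAbelianGroup.of Δ.obj₃)}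

instance : AddCommGroup (K0 T) := inferInstanceAs (AddCommGroup (FreeAbelianGroup T ⧸ _))

variable {T}

/-- The class of an object in the Grothendieck group. -/
def K0.of (X : T) : K0 T := QuotientAddGroup.mk (FreeAbelianGroup.of X)

lemma K0.of_obj₂ (Δ : Triangle T) (h : Δ ∈ distTriang T) :
    K0.of Δ.obj₂ = K0.of Δ.obj₁ + K0.of Δ.obj₃ :=
  QuotientAddGroup.eq_iff_sub_mem.2 (AddSubgroup.subset_closure ⟨Δ, h, rfl⟩)

lemma K0.of_eq_of_iso {X Y : T} (e : X ≅ Y) : K0.of X = K0.of Y := by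
  have h₁ := K0.of_obj₂ _ (contractible_distinguished X)
  have h₂ := K0.of_obj₂ (Triangle.mk e.hom (0 : Y ⟶ 0) 0)
    (isomorphic_distinguished _ (contractible_distinguished X) _
      (Triangle.isoMk _ _ (Iso.refl X) e.symm (Iso.refl (0 : T))
        (e.hom_inv_id.trans (Category.comp_id _).symm) (zero_comp.trans comp_zero.symm)
        (zero_comp.trans comp_zero.symm)))
  exact h₁.trans h₂.symm

end Triangulated

section Rigid

variable {T : Type*} [Category* T] [Preadditive T] [HasShift T ℤ]

/-- `X` is rigid if there is no nonzero morphism `X ⟶ X[1]`. -/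
def IsRigid (X : T) : Prop := ∀ f : X ⟶ X⟦(1 : ℤ)⟧, f = 0

lemma IsRigid.of_retract {X Y : T} (h : Retract X Y) (hY : IsRigid Y) : IsRigid X := by
  intro f
  have h₁ := hY (h.r ≫ f ≫ h.i⟦(1 : ℤ)⟧')
  calc f = (h.i ≫ h.r) ≫ f ≫ (h.i ≫ h.r)⟦(1 : ℤ)⟧' := by simp
    _ = h.i ≫ (h.r ≫ f ≫ h.i⟦(1 : ℤ)⟧') ≫ h.r⟦(1 : ℤ)⟧' := by
      simp only [Functor.map_comp, Category.assoc]
    _ = 0 := by rw [h₁]; simp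

end Rigid

/-! ### The 2-term silting complex -/

section Silting

variable (A : Type u) [Ring A]

/-- The finitely generated projective right `A`-modules. -/
def finiteProjective : ObjectProperty (ModuleCat.{u} Aᵐᵒᵖ) :=
  fun M => Module.Finite Aᵐᵒᵖ M ∧ Module.Projective Aᵐᵒᵖ M

instance : (finiteProjective A).IsClosedUnderIsomorphisms where
  of_iso {M N} e h := by
    have := h.1
    have := h.2
    exact ⟨Module.Finite.equiv e.toLinearEquiv, Module.Projective.of_equiv e.toLinearEquiv⟩

instance : (finiteProjective A).ContainsZero where
  exists_zero := ⟨ModuleCat.of Aᵐᵒᵖ PUnit.{u + 1}, ModuleCat.isZero_of_subsingleton _,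
    inferInstanceAs (Module.Finite Aᵐᵒᵖ PUnit.{u + 1}),
    inferInstanceAs (Module.Projective Aᵐᵒᵖ PUnit.{u + 1})⟩

instance : (finiteProjective A).IsClosedUnderBinaryProducts :=
  .mk' (by
    rintro _ ⟨F, hF⟩
    obtain ⟨_, _⟩ := hF ⟨WalkingPair.left⟩
    obtain ⟨_, _⟩ := hF ⟨WalkingPair.right⟩
    refine (finiteProjective A).prop_of_iso
      ((HasLimit.isoOfNatIso (diagramIsoPair F)).trans (IsLimit.conePointUniqueUpToIso
        (limit.isLimit _) (ModuleCat.binaryProductLimitCone _ _).isLimit)).symm ?_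
    exact ⟨inferInstanceAs (Module.Finite Aᵐᵒᵖ (F.obj ⟨.left⟩ × F.obj ⟨.right⟩)),
      inferInstanceAs (Module.Projective Aᵐᵒᵖ (F.obj ⟨.left⟩ × F.obj ⟨.right⟩))⟩)

/-- The category of finitely generated projective right `A`-modules. -/
abbrev Proj : Type (u + 1) := (finiteProjective A).FullSubcategory

instance : HasBinaryProducts (Proj A) := inferInstance

instance : HasBinaryBiproducts (Proj A) := HasBinaryBiproducts.of_hasBinaryProducts

/-- The bounded homotopy category of finitely generated projective right `A`-modules. -/
abbrev KbProj : Type (u + 1) := BoundedHomotopyCategory (Proj A)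

variable {A}

/-- The projective right module `e A`, for an idempotent `e`. -/
def idempotentProj (e : A) (he : IsIdempotentElem e) : Proj A where
  obj := ModuleCat.of Aᵐᵒᵖ (Submodule.span Aᵐᵒᵖ {e})
  property := by
    have hmul : ∀ x ∈ Submodule.span Aᵐᵒᵖ {e}, e * x = x := by
      intro x hx
      obtain ⟨a, rfl⟩ := Submodule.mem_span_singleton.1 hx
      rw [mul_smul_comm, he.eq]
    refine ⟨inferInstanceAs (Module.Finite Aᵐᵒᵖ (Submodule.span Aᵐᵒᵖ {e})),
      Module.Projective.of_split (P := Submodule.span Aᵐᵒᵖ {e}) (M := Aᵐᵒᵖ)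
        { toFun := fun x => MulOpposite.op x.1
          map_add' := fun _ _ => rfl
          map_smul' := fun _ _ => rfl }
        (LinearMap.toSpanSingleton Aᵐᵒᵖ (Submodule.span Aᵐᵒᵖ {e})
          ⟨e, Submodule.mem_span_singleton_self e⟩) ?_⟩
    ext x
    exact hmul x.1 x.2

variable (A)

/-- The indecomposable rigid 2-term objects. -/
def IndecomposableRigid : Type (u + 1) :=
  {X : KbProj A // IsTwoTerm X ∧ IsRigid X ∧ Indecomposable X}

/-- Isomorphism in the bounded homotopy category. -/
instance indecomposableRigidSetoid : Setoid (IndecomposableRigid A) where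
  r X Y := Nonempty (X.1 ≅ Y.1)
  iseqv := ⟨fun _ => ⟨Iso.refl _⟩, fun ⟨e⟩ => ⟨e.symm⟩, fun ⟨e⟩ ⟨e'⟩ => ⟨e.trans e'⟩⟩

/-- The isomorphism classes of indecomposable rigid 2-term objects. -/
def SiltingVertex : Type (u + 1) := Quotient (indecomposableRigidSetoid A)

variable {A}

/-- An object in the given isomorphism class. -/
def SiltingVertex.rep (v : SiltingVertex A) : KbProj A := (Quotient.out v).1

lemma SiltingVertex.isRigid_rep (v : SiltingVertex A) : IsRigid v.rep := (Quotient.out v).2.2.1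

/-- The g-vector of an (isomorphism class of an) object: its class in the Grothendieck group of the
bounded homotopy category of projectives. -/
def SiltingVertex.gVector (v : SiltingVertex A) : K0 (KbProj A) :=
  Quotient.lift (s := indecomposableRigidSetoid A) (fun X : IndecomposableRigid A => K0.of X.1)
    (fun X Y (h : Nonempty (X.1 ≅ Y.1)) => h.elim K0.of_eq_of_iso) v

variable (A)

/-- The 2-term silting complex: its vertices are the isomorphism classes of indecomposable rigid
2-term objects, its faces are the (nonempty, finite) sets of such objects whose direct sum is
rigid. -/
def siltingComplex : AbstractSimplicialComplex (SiltingVertex A) where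
  faces := {s | s.Nonempty ∧ IsRigid (⨁ fun v : s => SiltingVertex.rep v.1)}
  isRelLowerSet_faces := by
    rintro s ⟨hs, h⟩
    refine ⟨hs, fun t hts ht => ⟨ht, ?_⟩⟩
    classical
    refine IsRigid.of_retract (Y := ⨁ fun v : s => SiltingVertex.rep v.1)
      ⟨biproduct.desc fun v => biproduct.ι (fun v : s => SiltingVertex.rep v.1) ⟨v.1, hts v.2⟩,
        biproduct.lift fun v => biproduct.π (fun v : s => SiltingVertex.rep v.1) ⟨v.1, hts v.2⟩,
        ?_⟩ h
    refine biproduct.hom_ext' _ _ fun v => biproduct.hom_ext _ _ fun w => ?_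
    simp [biproduct.ι_π]
  singleton_mem v := by
    refine ⟨Finset.singleton_nonempty v, ?_⟩
    refine IsRigid.of_retract (Y := v.rep)
      ⟨biproduct.desc fun w => eqToHom (by rw [Finset.mem_singleton.1 w.2]),
        biproduct.lift fun w => eqToHom (by rw [Finset.mem_singleton.1 w.2]), ?_⟩ v.isRigid_rep
    refine biproduct.hom_ext' _ _ fun w₁ => biproduct.hom_ext _ _ fun w₂ => ?_
    obtain rfl : w₁ = w₂ := Subsingleton.elim _ _
    simp

variable {A}

/-- The coordinate subspace (subgroup) of the Grothendieck group spanned by the classes of the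
projective modules `e j A`, concentrated in degree `0`, for `j` in `J`. -/
def coordinateSubspace {V : Type u} (e : V → A) (he : ∀ i, IsIdempotentElem (e i))
    (J : Finset V) : AddSubgroup (K0 (KbProj A)) :=
  AddSubgroup.closure {x | ∃ j ∈ J, x = K0.of (inDegreeZero (idempotentProj (e j) (he j)))}

end Silting

/-! ### Simplicial complexes -/

section SimplicialComplexes

variable {α β : Type*}

/-- The subcomplex of `K` induced by a set `S` of vertices: its faces are the faces of `K` all of
whose vertices are in `S`. -/
def inducedSubcomplex (K : AbstractSimplicialComplex α) (S : Set α) :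
    AbstractSimplicialComplex S where
  faces := {s | s.map (Function.Embedding.subtype _) ∈ K.faces}
  isRelLowerSet_faces := by
    intro s hs
    have h := K.isRelLowerSet_faces hs
    exact ⟨Finset.map_nonempty.1 h.1, fun t hts ht =>
      h.2 (Finset.map_subset_map.2 hts) (Finset.map_nonempty.2 ht)⟩
  singleton_mem v := by
    simpa using K.singleton_mem v.1

/-- Two simplicial complexes are isomorphic if there is a bijection between their vertices which
induces a bijection between their faces. -/
def AreIsomorphic (K : AbstractSimplicialComplex α) (L : AbstractSimplicialComplex β) : Prop :=
  ∃ φ : α ≃ β, ∀ s : Finset α, s ∈ K.faces ↔ s.map φ.toEmbedding ∈ L.faces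

end SimplicialComplexes

end GentleSilting

end

/-! Let `e` be the sum of the idempotents `e_j`, `j ∈ J`, in the algebra `Λ` of the quiver with
relations. Then `eΛe` is the algebra of the shortcut quiver. Indeed the relations are monomial, so
the paths avoiding relations form a basis of `Λ`, and such a path between vertices of `J` is cut in
exactly one way, at its visits to `J`, into arrows of the shortcut quiver (`flatten_injective`,
`exists_flatten_eq`, `avoidsRelations_flatten_iff`, combined in `exists_shortcutHom_eq_iff`). Since
`eΛe = End(eΛ)`, the projectives over `eΛe` are the direct summands of finite sums of copies of `eΛ`
(`exists_fullyFaithful_of_end_equiv`), that is, the projective `Λ`-modules whose top is supported on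
`J` (`addClosure_idempotentProj_iff`).

The resulting functor on bounded homotopy categories is fully faithful and commutes with the shift,
so it preserves and reflects rigidity. Two points remain.

The image on indecomposable rigid two-term objects is cut out by g-vectors. The class of `P₁ ⟶ P₀`
is `[P₀] - [P₁]`, so images lie in the coordinate subspace. Conversely, choose a minimal
representative, whose differential vanishes on tops. If the projective of a vertex `i` were a
summand of both terms, a map `P₁ ⟶ P₀` through it that is nonzero on tops would contradict rigidity
(`IsMinimal.mult_eq_zero`). So nothing cancels in the g-vector: if its coordinate at `i` is zero,
then `i` occurs in neither term. Coordinates are well defined on the Grothendieck group as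
alternating sums of multiplicities (`coordinate`).

Indecomposability is preserved. Null-homotopic endomorphisms of a minimal complex are nilpotent, so
idempotents lift from the homotopy category; a summand of a two-term object is thus represented by a
complex whose terms are summands of the given ones (`exists_isTwoTermComplex_of_retract`).

The module theory is carried out for a `VertexSystem`: idempotents and matching characters with
nilpotent common kernel. For `Λ` the nilpotency comes from the bound on the length of nonzero paths.
-/

noncomputable section

namespace GentleSilting

open CategoryTheory CategoryTheory.Limits CategoryTheory.Pretriangulated ZeroObject

/-! ### Rigidity of direct sums -/

section Rigidity

variable {T : Type*} [Category* T] [Preadditive T] [HasShift T ℤ]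

/-- There is no nonzero morphism `X ⟶ Y[1]`. -/
def HomShiftZero (X Y : T) : Prop := ∀ f : X ⟶ Y⟦(1 : ℤ)⟧, f = 0

lemma HomShiftZero.of_retract {X Y X' Y' : T} (h : HomShiftZero X Y) (a : Retract X' X)
    (b : Retract Y' Y) : HomShiftZero X' Y' := by
  intro f
  have h₁ := h (a.r ≫ f ≫ b.i⟦(1 : ℤ)⟧')
  calc f = (a.i ≫ a.r) ≫ f ≫ (b.i ≫ b.r)⟦(1 : ℤ)⟧' := by simp
    _ = a.i ≫ (a.r ≫ f ≫ b.i⟦(1 : ℤ)⟧') ≫ b.r⟦(1 : ℤ)⟧' := by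
      simp only [Functor.map_comp, Category.assoc]
    _ = 0 := by rw [h₁]; simp

lemma homShiftZero_iff_of_iso {X Y X' Y' : T} (a : X' ≅ X) (b : Y' ≅ Y) :
    HomShiftZero X Y ↔ HomShiftZero X' Y' :=
  ⟨fun h => h.of_retract a.retract b.retract, fun h => h.of_retract a.symm.retract b.symm.retract⟩

lemma isRigid_biproduct_iff [∀ n : ℤ, (shiftFunctor T n).Additive] [HasFiniteBiproducts T]
    {ι : Type*} [Finite ι] (X : ι → T) :
    IsRigid (⨁ X) ↔ ∀ i j, HomShiftZero (X i) (X j) := by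
  classical
  have := Fintype.ofFinite ι
  constructor
  · intro h i j
    exact HomShiftZero.of_retract (X := ⨁ X) (Y := ⨁ X) h
      ⟨biproduct.ι X i, biproduct.π X i, by simp⟩ ⟨biproduct.ι X j, biproduct.π X j, by simp⟩
  · intro h f
    -- The identity of the target is resolved before shifting, so that the shift of a biproduct need
    -- not be identified with a biproduct of shifts.
    have h₁ : f = f ≫ (∑ j, biproduct.π X j ≫ biproduct.ι X j)⟦(1 : ℤ)⟧' := by
      rw [IsBilimit.total (biproduct.isBilimit X)]; simp
    rw [h₁]
    refine biproduct.hom_ext' _ _ fun i => ?_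
    rw [Functor.map_sum, Preadditive.comp_sum, Preadditive.comp_sum, comp_zero]
    refine Finset.sum_eq_zero fun j _ => ?_
    have h₂ := h i j (biproduct.ι X i ≫ f ≫ (biproduct.π X j)⟦(1 : ℤ)⟧')
    simp only [Functor.map_comp]
    rw [← Category.assoc f, ← Category.assoc, h₂, zero_comp]

end Rigidity

/-! ### Projective modules over an endomorphism ring -/

section AddClosure

variable {C : Type*} [Category.{u} C] [Preadditive C]

/-- The direct summands of finite direct sums of copies of `X`. -/
def addClosure (X : C) : ObjectProperty C :=
  fun Y => ∃ (n : ℕ) (i : Fin n → (Y ⟶ X)) (r : Fin n → (X ⟶ Y)), ∑ t, i t ≫ r t = 𝟙 Y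

lemma addClosure.of_retract {X Y Z : C} (h : addClosure X Y) (p : Retract Z Y) :
    addClosure X Z := by
  obtain ⟨n, i, r, h⟩ := h
  refine ⟨n, fun t => p.i ≫ i t, fun t => r t ≫ p.r, ?_⟩
  simp only [Category.assoc]
  rw [← Preadditive.comp_sum]
  simp only [← Category.assoc (i _)]
  rw [← Preadditive.sum_comp, h]
  simp

lemma addClosure_of_isZero {X Y : C} (h : IsZero Y) : addClosure X Y :=
  ⟨0, fun _ => 0, fun _ => 0, h.eq_of_src _ _⟩

/-- The functor `Hom(X, -)`, with values in the right modules over the endomorphism ring of `X`. -/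
def homFunctor {B : Type u} [Ring B] (X : C) (σ : B ≃+* End X) : C ⥤ ModuleCat.{u} Bᵐᵒᵖ :=
  preadditiveCoyonedaObj X ⋙ ModuleCat.restrictScalars (RingHom.op (σ : B →+* End X))

variable {B : Type u} [Ring B] (X : C) (σ : B ≃+* End X)

instance : (homFunctor X σ).Additive := by
  unfold homFunctor; infer_instance

variable {X}

/-- A linear map between two values of `homFunctor`, as a map between groups of morphisms. -/
def homFunctor.mapHom {Y Z : C} (g : (homFunctor X σ).obj Y ⟶ (homFunctor X σ).obj Z) :
    (X ⟶ Y) →+ (X ⟶ Z) :=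
  g.hom.toAddMonoidHom

/-- Linearity over `B` is naturality for endomorphisms of `X`, because `σ` reaches all of them. -/
lemma homFunctor.mapHom_comp {Y Z : C} (g : (homFunctor X σ).obj Y ⟶ (homFunctor X σ).obj Z)
    (w : X ⟶ X) (u : X ⟶ Y) : mapHom σ g (w ≫ u) = w ≫ mapHom σ g u := by
  have h : ∀ b : B, mapHom σ g (σ b ≫ u) = σ b ≫ mapHom σ g u := fun b =>
    g.hom.map_smul (MulOpposite.op b) u
  simpa using h (σ.symm w)

lemma homFunctor.map_eq_iff {Y Z : C} (g : (homFunctor X σ).obj Y ⟶ (homFunctor X σ).obj Z)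
    (f : Y ⟶ Z) : (homFunctor X σ).map f = g ↔ ∀ u : X ⟶ Y, u ≫ f = mapHom σ g u :=
  ⟨fun h u => by rw [← h]; rfl, fun h => by ext u; exact h u⟩

/-- The identity of `Y` factors through copies of `X`, so morphisms from `Y` are tested on morphisms
from `X`. -/
lemma homFunctor.map_injective {Y Z : C} (hY : addClosure X Y) {f f' : Y ⟶ Z}
    (h : (homFunctor X σ).map f = (homFunctor X σ).map f') : f = f' := by
  obtain ⟨n, i, r, hr⟩ := hY
  have h' := (homFunctor.map_eq_iff σ _ f).1 h
  calc f = (∑ t, i t ≫ r t) ≫ f := by rw [hr, Category.id_comp]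
    _ = (∑ t, i t ≫ r t) ≫ f' := by
      simp only [Preadditive.sum_comp, Category.assoc]
      exact Finset.sum_congr rfl fun t _ => by rw [h']; rfl
    _ = f' := by rw [hr, Category.id_comp]

/-- The preimage is forced: with `𝟙 Y = ∑ i t ≫ r t`, it must be the sum of the `i t ≫ g (r t)`. -/
lemma homFunctor.exists_map_eq {Y Z : C} (hY : addClosure X Y)
    (g : (homFunctor X σ).obj Y ⟶ (homFunctor X σ).obj Z) :
    ∃ f : Y ⟶ Z, (homFunctor X σ).map f = g := by
  obtain ⟨n, i, r, hr⟩ := hY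
  refine ⟨∑ t, i t ≫ mapHom σ g (r t), (homFunctor.map_eq_iff σ _ _).2 fun u => ?_⟩
  calc u ≫ ∑ t, i t ≫ mapHom σ g (r t) = ∑ t, mapHom σ g ((u ≫ i t) ≫ r t) := by
        rw [Preadditive.comp_sum]
        exact Finset.sum_congr rfl fun t _ => by
          rw [homFunctor.mapHom_comp, Category.assoc]
    _ = mapHom σ g u := by
        rw [← map_sum]
        simp only [Category.assoc]
        rw [← Preadditive.comp_sum, hr, Category.comp_id]

/-- Composition with morphisms to `X`, as a linear map. -/
def homFunctor.coords {Y : C} {n : ℕ} (i : Fin n → (Y ⟶ X)) :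
    (homFunctor X σ).obj Y →ₗ[Bᵐᵒᵖ] (Fin n → Bᵐᵒᵖ) :=
  LinearMap.pi fun t =>
    { toFun := fun u : X ⟶ Y => MulOpposite.op (σ.symm (u ≫ i t))
      map_add' := fun (u v : X ⟶ Y) => by
        have h : (u + v) ≫ i t = u ≫ i t + v ≫ i t := Preadditive.add_comp ..
        exact congrArg (fun x => MulOpposite.op (σ.symm x)) h |>.trans
          (congrArg MulOpposite.op (map_add σ.symm (u ≫ i t) (v ≫ i t)))
      map_smul' := fun b (u : X ⟶ Y) => by
        change MulOpposite.op (σ.symm ((σ b.unop ≫ u) ≫ i t)) =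
          b * MulOpposite.op (σ.symm (u ≫ i t))
        have h : (σ b.unop ≫ u) ≫ i t = End.of (u ≫ i t) * σ b.unop := Category.assoc ..
        rw [h, map_mul, RingEquiv.symm_apply_apply]
        rfl }

/-- The linear combinations of morphisms from `X`. -/
def homFunctor.comb {Y : C} {n : ℕ} (r : Fin n → (X ⟶ Y)) :
    (Fin n → Bᵐᵒᵖ) →ₗ[Bᵐᵒᵖ] (homFunctor X σ).obj Y :=
  Fintype.linearCombination Bᵐᵒᵖ (fun t => (r t : (homFunctor X σ).obj Y))

lemma homFunctor.comb_coords {Y : C} {n : ℕ} {i : Fin n → (Y ⟶ X)} {r : Fin n → (X ⟶ Y)}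
    (hr : ∑ t, i t ≫ r t = 𝟙 Y) : comb σ r ∘ₗ coords σ i = LinearMap.id := by
  refine LinearMap.ext fun (u : X ⟶ Y) => ?_
  have h : ∑ t, σ (σ.symm (u ≫ i t)) ≫ r t = u := by
    calc _ = ∑ t, u ≫ i t ≫ r t := Finset.sum_congr rfl fun t _ => by
          rw [RingEquiv.apply_symm_apply, Category.assoc]
      _ = u := by rw [← Preadditive.comp_sum, hr, Category.comp_id]
  exact h

lemma finiteProjective_homFunctor_obj {Y : C} (hY : addClosure X Y) :
    finiteProjective B ((homFunctor X σ).obj Y) := by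
  obtain ⟨n, i, r, hr⟩ := hY
  have h := homFunctor.comb_coords σ hr
  exact ⟨Module.Finite.of_surjective (homFunctor.comb σ r)
    fun u => ⟨homFunctor.coords σ i u, LinearMap.congr_fun h u⟩,
    Module.Projective.of_split _ _ h⟩

variable (X) in
/-- The functor `Hom(X, -)` from the direct summands of the finite direct sums of copies of `X` to
the projective modules over the endomorphism ring of `X`. -/
def addToProj : (addClosure X).FullSubcategory ⥤ Proj B :=
  (finiteProjective B).lift ((addClosure X).ι ⋙ homFunctor X σ)
    fun Y => finiteProjective_homFunctor_obj σ Y.property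

instance : (addToProj X σ).Additive where
  map_add {Y Z f g} := by
    ext : 1
    exact (homFunctor X σ).map_add

instance : (addToProj X σ).Faithful where
  map_injective {Y Z f g} h := by
    ext : 1
    exact homFunctor.map_injective σ Y.property (congrArg (·.hom) h)

instance : (addToProj X σ).Full where
  map_surjective {Y Z} g := by
    obtain ⟨f, hf⟩ := homFunctor.exists_map_eq σ Y.property g.hom
    exact ⟨ObjectProperty.homMk f, by ext : 1; exact hf⟩

/-- The idempotent on `Hom(X, Y)` defined by the retract comes from an idempotent of `Y` by full
faithfulness, and the latter splits in `C`. -/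
lemma homFunctor.exists_iso_of_retract [IsIdempotentComplete C] {Y : C} (hY : addClosure X Y)
    {M : ModuleCat.{u} Bᵐᵒᵖ} (r : Retract M ((homFunctor X σ).obj Y)) :
    ∃ Z, addClosure X Z ∧ Nonempty ((homFunctor X σ).obj Z ≅ M) := by
  obtain ⟨p, hp⟩ := homFunctor.exists_map_eq σ hY (r.r ≫ r.i)
  have hpp : p ≫ p = p := homFunctor.map_injective σ hY (by
    rw [Functor.map_comp, hp, Category.assoc, r.retract_assoc])
  obtain ⟨Z, i, e, hie, hei⟩ := IsIdempotentComplete.idempotents_split Y p hpp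
  refine ⟨Z, hY.of_retract ⟨i, e, hie⟩, ⟨
    { hom := (homFunctor X σ).map i ≫ r.r
      inv := r.i ≫ (homFunctor X σ).map e
      hom_inv_id := ?_
      inv_hom_id := ?_ }⟩⟩
  · rw [Category.assoc, ← Category.assoc r.r, ← hp, ← Functor.map_comp, ← Functor.map_comp, ← hei,
      Category.assoc, hie, Category.comp_id, hie, CategoryTheory.Functor.map_id]
  · rw [Category.assoc, ← Category.assoc ((homFunctor X σ).map e), ← Functor.map_comp, hei, hp,
      Category.assoc, r.retract, Category.comp_id, r.retract]

/-- A finitely generated projective module is a retract of some `B ^ n`, which is `Hom(X, X ^ n)`.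
-/
lemma addToProj_essSurj [HasFiniteBiproducts C] [IsIdempotentComplete C] :
    (addToProj X σ).EssSurj where
  mem_essImage P := by
    have hfin := P.property.1
    have hproj := P.property.2
    obtain ⟨n, f, hf⟩ := Module.Finite.exists_fin' Bᵐᵒᵖ P.obj
    obtain ⟨g, hg⟩ := Module.projective_lifting_property f LinearMap.id hf
    have hY : addClosure X (⨁ fun _ : Fin n => X) :=
      ⟨n, biproduct.π _, biproduct.ι _, biproduct.total⟩
    let a := homFunctor.coords σ (biproduct.π fun _ : Fin n => X)
    let b := homFunctor.comb σ (biproduct.ι fun _ : Fin n => X)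
    have hab : ∀ c, a (b c) = c := by
      intro c
      funext s
      have h : (∑ t, σ (c t).unop ≫ biproduct.ι (fun _ : Fin n => X) t) ≫
          biproduct.π (fun _ : Fin n => X) s = σ (c s).unop := by
        rw [Preadditive.sum_comp, Finset.sum_eq_single s]
        · simp
        · intro t _ hts
          simp [biproduct.ι_π_ne _ hts]
        · simp
      refine (congrArg (fun x => MulOpposite.op (σ.symm x)) h).trans ?_
      simp
    obtain ⟨Z, hZ, ⟨e⟩⟩ := homFunctor.exists_iso_of_retract σ hY (M := P.obj)
      { i := ModuleCat.homEquiv.symm (b ∘ₗ g)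
        r := ModuleCat.homEquiv.symm (f ∘ₗ a)
        retract := by
          ext x
          exact (congrArg f (hab (g x))).trans (LinearMap.congr_fun hg x) }
    exact ⟨⟨Z, hZ⟩, ⟨(finiteProjective B).isoMk e⟩⟩

/-- The fully faithful functor from the projective modules over the endomorphism ring of `X` whose
essential image consists of the direct summands of finite direct sums of copies of `X`. -/
lemma exists_fullyFaithful_of_end_equiv (σ : B ≃+* End X) [HasFiniteBiproducts C] [IsIdempotentComplete C] :
    ∃ F : Proj B ⥤ C, F.Full ∧ F.Faithful ∧ F.Additive ∧
      ∀ Y, F.essImage Y ↔ addClosure X Y := by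
  have := addToProj_essSurj (X := X) σ
  have : (addToProj X σ).IsEquivalence := {}
  have : (addToProj X σ).asEquivalence.functor.Additive :=
    inferInstanceAs (addToProj X σ).Additive
  have : (addToProj X σ).inv.Additive := (addToProj X σ).asEquivalence.inverse_additive
  refine ⟨(addToProj X σ).inv ⋙ (addClosure X).ι, inferInstance, inferInstance, inferInstance,
    fun Y => ⟨?_, fun hY => ?_⟩⟩
  · rintro ⟨P, ⟨e⟩⟩
    exact ((addToProj X σ).inv.obj P).property.of_retract e.symm.retract
  · exact ⟨(addToProj X σ).obj ⟨Y, hY⟩, ⟨(addClosure X).ι.mapIso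
      ((addToProj X σ).asEquivalence.unitIso.symm.app ⟨Y, hY⟩)⟩⟩

end AddClosure

/-! ### Algebras with a nilpotent radical and split semisimple quotient -/

section VertexSystem

/-- The field `k`, as a module over `R` by means of a ring homomorphism `φ : R →+* k`. -/
def CharModule {R k : Type*} [Ring R] [Field k] (_φ : R →+* k) : Type _ := k

namespace CharModule

variable {R k : Type*} [Ring R] [Field k] (φ : R →+* k)

instance : AddCommGroup (CharModule φ) := inferInstanceAs (AddCommGroup k)

instance : Module k (CharModule φ) := inferInstanceAs (Module k k)

instance : Module.Finite k (CharModule φ) := inferInstanceAs (Module.Finite k k)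

instance : Module R (CharModule φ) := Module.compHom k φ

instance : Nontrivial (CharModule φ) := inferInstanceAs (Nontrivial k)

/-- The generator of `CharModule φ`. -/
def one : CharModule φ := (1 : k)

lemma smul_def (r : R) (x : CharModule φ) : r • x = φ r • x := rfl

lemma smul_one (c : k) : c • one φ = (show CharModule φ from c) := mul_one c

instance : SMulCommClass R k (CharModule φ) where
  smul_comm r c x := by rw [smul_def, smul_def, smul_comm]

lemma exists_smul_eq {x : CharModule φ} (hx : x ≠ 0) : ∃ c : k, c • x = one φ :=
  ⟨(show k from x)⁻¹, inv_mul_cancel₀ (show (show k from x) ≠ 0 from hx)⟩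

instance finite_linearMap {M : Type*} [AddCommGroup M] [Module R M] [Module.Finite R M] :
    Module.Finite k (M →ₗ[R] CharModule φ) := by
  obtain ⟨n, f, hf⟩ := Module.Finite.exists_fin' R M
  let ev : (M →ₗ[R] CharModule φ) →ₗ[k] (Fin n → CharModule φ) :=
    { toFun := fun l t => l (f (Pi.single t 1))
      map_add' := fun _ _ => rfl
      map_smul' := fun _ _ => rfl }
  refine Module.Finite.of_injective ev fun l l' h => ?_
  have h₁ : l ∘ₗ f = l' ∘ₗ f := by
    refine LinearMap.pi_ext' fun t => LinearMap.ext_ring ?_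
    exact congrFun h t
  exact LinearMap.ext fun x => by
    obtain ⟨y, rfl⟩ := hf x
    exact LinearMap.congr_fun h₁ y

end CharModule

/-- Idempotents `e i` of the ring `A` together with characters `aug i` of `A` such that the
characters split the idempotents and their common kernel is nilpotent. -/
structure VertexSystem (A k V : Type*) [Ring A] [Field k] where
  /-- the idempotents -/
  e : V → A
  isIdempotentElem_e : ∀ i, IsIdempotentElem (e i)
  /-- the characters -/
  aug : V → A →+* k
  aug_self : ∀ i, aug i (e i) = 1
  aug_ne : ∀ i j, j ≠ i → aug i (e j) = 0
  aug_surjective : ∀ i, Function.Surjective (aug i)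
  nilpotent : ∃ N : ℕ, ∀ l : List A, l.length = N → (∀ x ∈ l, ∀ i, aug i x = 0) → l.prod = 0

namespace VertexSystem

variable {A k V : Type*} [Ring A] [Field k] (S : VertexSystem A k V)

/-- The character of the opposite ring. -/
def augOp (i : V) : Aᵐᵒᵖ →+* k := (S.aug i).fromOpposite fun _ _ => Commute.all _ _

lemma augOp_op (i : V) (a : A) : S.augOp i (MulOpposite.op a) = S.aug i a := rfl

lemma augOp_surjective (i : V) : Function.Surjective (S.augOp i) := fun c =>
  let ⟨a, ha⟩ := S.aug_surjective i c
  ⟨MulOpposite.op a, ha⟩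

/-- The linear functionals on `M` that are compatible with the character of the vertex `i`. -/
abbrev Top (i : V) (M : Type*) [AddCommGroup M] [Module Aᵐᵒᵖ M] : Type _ :=
  M →ₗ[Aᵐᵒᵖ] CharModule (S.augOp i)

variable {S}

/-- Such an `f` maps `M` into `M` times the common kernel of the characters: in a dual basis of the
projective module `M`, all coefficients of `f m` lie in that kernel. Iterating `f` multiplies such
coefficients, and long products of them vanish. -/
lemma isNilpotent_of_forall_comp_eq_zero {M : Type*} [AddCommGroup M] [Module Aᵐᵒᵖ M]
    [Module.Finite Aᵐᵒᵖ M] [Module.Projective Aᵐᵒᵖ M] (f : Module.End Aᵐᵒᵖ M)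
    (hf : ∀ i (l : S.Top i M), l ∘ₗ f = 0) : IsNilpotent f := by
  obtain ⟨n, p, hp⟩ := Module.Finite.exists_fin' Aᵐᵒᵖ M
  obtain ⟨g, hg⟩ := Module.projective_lifting_property p LinearMap.id hp
  have hsum : ∀ m : M, m = ∑ t, g m t • p (Pi.single t 1) := by
    intro m
    conv_lhs => rw [← LinearMap.id_apply (R := Aᵐᵒᵖ) m, ← hg, LinearMap.comp_apply,
      LinearMap.pi_apply_eq_sum_univ p (g m)]
    refine Finset.sum_congr rfl fun t _ => ?_
    congr 2
    funext j
    simp [Pi.single_apply, eq_comm]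
  have hc : ∀ m t i, S.aug i (g (f m) t).unop = 0 := by
    intro m t i
    let q : Aᵐᵒᵖ →ₗ[Aᵐᵒᵖ] CharModule (S.augOp i) :=
      LinearMap.toSpanSingleton Aᵐᵒᵖ _ (CharModule.one _)
    have h := LinearMap.congr_fun (hf i (q ∘ₗ LinearMap.proj t ∘ₗ g)) m
    change (g (f m) t) • CharModule.one (S.augOp i) = 0 at h
    rw [CharModule.smul_def, CharModule.smul_one] at h
    exact h
  obtain ⟨N, hN⟩ := S.nilpotent
  -- The list `l` collects the coefficients already extracted. Each application of `f` adds one at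
  -- the front, since scalars act through the opposite ring.
  have key : ∀ n (l : List A), l.length + n = N → (∀ x ∈ l, ∀ i, S.aug i x = 0) →
      ∀ m : M, MulOpposite.op l.prod • (f ^ n) m = 0 := by
    intro n
    induction n with
    | zero =>
      intro l hl hx m
      rw [hN l hl hx, MulOpposite.op_zero, zero_smul]
    | succ n ih =>
      intro l hl hx m
      rw [pow_succ, Module.End.mul_apply, hsum (f m), map_sum, Finset.smul_sum]
      refine Finset.sum_eq_zero fun t _ => ?_
      rw [map_smul, smul_smul]
      have := ih ((g (f m) t).unop :: l) (by simp; omega) (by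
        simp only [List.mem_cons, forall_eq_or_imp]
        exact ⟨hc m t, hx⟩) (p (Pi.single t 1))
      simpa using this
  refine ⟨N, LinearMap.ext fun m => ?_⟩
  simpa using key N [] (by simp) (by simp) m

variable (S)

/-- The projective module of the vertex `i`. -/
abbrev P (i : V) : Submodule Aᵐᵒᵖ A := Submodule.span Aᵐᵒᵖ {S.e i}

/-- The generator of the projective module of the vertex `i`. -/
def gen (i : V) : S.P i := ⟨S.e i, Submodule.mem_span_singleton_self _⟩

lemma op_smul_gen (i : V) : MulOpposite.op (S.e i) • S.gen i = S.gen i :=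
  Subtype.ext (S.isIdempotentElem_e i)

lemma exists_smul_gen {i : V} (x : S.P i) : ∃ a : Aᵐᵒᵖ, x = a • S.gen i := by
  obtain ⟨a, ha⟩ := Submodule.mem_span_singleton.1 x.2
  exact ⟨a, Subtype.ext ha.symm⟩

/-- The linear map from the projective module of a vertex that is determined by the image of the
generator. -/
def lift (i : V) {M : Type*} [AddCommGroup M] [Module Aᵐᵒᵖ M] (m : M) : S.P i →ₗ[Aᵐᵒᵖ] M where
  toFun x := MulOpposite.op x.1 • m
  map_add' x y := by simp [add_smul]
  map_smul' a x := by
    rw [RingHom.id_apply, smul_smul]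
    rfl

lemma lift_gen (i : V) {M : Type*} [AddCommGroup M] [Module Aᵐᵒᵖ M] (m : M) :
    S.lift i m (S.gen i) = MulOpposite.op (S.e i) • m := rfl

lemma top_apply_gen_of_ne {i j : V} (h : j ≠ i) (l : S.Top i (S.P j)) : l = 0 := by
  refine LinearMap.ext fun x => ?_
  obtain ⟨a, rfl⟩ := S.exists_smul_gen x
  rw [← op_smul_gen, map_smul, map_smul, CharModule.smul_def _ (MulOpposite.op (S.e j)), augOp_op,
    S.aug_ne i j h]
  simp

/-- The canonical functional on the projective module of the vertex `i`. -/
def canon (i : V) : S.Top i (S.P i) := S.lift i (CharModule.one _)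

lemma canon_gen (i : V) : S.canon i (S.gen i) = CharModule.one _ := by
  rw [canon, lift_gen, CharModule.smul_def, augOp_op, S.aug_self, one_smul]

lemma canon_surjective (i : V) : Function.Surjective (S.canon i) := by
  intro x
  obtain ⟨a, ha⟩ := S.augOp_surjective i (show k from x)
  refine ⟨a • S.gen i, ?_⟩
  rw [map_smul, canon_gen, CharModule.smul_def, ha, CharModule.smul_one]

/-- The top of `P i` is one-dimensional and sits at the vertex `i`, so every functional on `P i`
kills the kernel of the canonical one. -/
lemma eq_of_canon_eq {i j : V} (l : S.Top j (S.P i)) {x : S.P i} (hx : S.canon i x = 0) :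
    l x = 0 := by
  by_cases h : i = j
  · subst h
    obtain ⟨a, rfl⟩ := S.exists_smul_gen x
    rw [map_smul, canon_gen, CharModule.smul_def, CharModule.smul_one] at hx
    have hx' : S.augOp i a = 0 := hx
    rw [map_smul, CharModule.smul_def, hx', zero_smul]
  · rw [S.top_apply_gen_of_ne h l]; rfl

lemma P_projective (i : V) : Module.Projective Aᵐᵒᵖ (S.P i) :=
  (idempotentProj (S.e i) (S.isIdempotentElem_e i)).property.2

/-- A linear map that is visible on the top of projective modules restricts to an isomorphism
between direct summands. -/
lemma exists_section {M N : Type*} [AddCommGroup M] [Module Aᵐᵒᵖ M] [AddCommGroup N]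
    [Module Aᵐᵒᵖ N] [Module.Projective Aᵐᵒᵖ N] (g : M →ₗ[Aᵐᵒᵖ] N) {i : V} (l : S.Top i N)
    (hl : l ∘ₗ g ≠ 0) :
    ∃ (s : S.P i →ₗ[Aᵐᵒᵖ] M) (r : N →ₗ[Aᵐᵒᵖ] S.P i),
      r ∘ₗ g ∘ₗ s = LinearMap.id ∧ S.canon i ∘ₗ r = l := by
  have := S.P_projective i
  obtain ⟨p, hp⟩ : ∃ p, l (g p) ≠ 0 := by
    by_contra! h
    exact hl (LinearMap.ext h)
  obtain ⟨c, hc⟩ := CharModule.exists_smul_eq _ hp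
  obtain ⟨a, ha⟩ := S.augOp_surjective i c
  -- Here `r` lifts `l` through the canonical functional, and `a` is chosen so that `u = r ∘ g ∘ s₁`
  -- is the identity on the top of `P i`. Then `1 - u` is nilpotent and `u` invertible; its inverse
  -- is absorbed into the section, so that the relation between `r` and `l` is kept.
  obtain ⟨r, hr⟩ := Module.projective_lifting_property (S.canon i) l (S.canon_surjective i)
  let s₁ := S.lift i (a • p)
  let u : Module.End Aᵐᵒᵖ (S.P i) := r ∘ₗ g ∘ₗ s₁
  have hu : S.canon i (u (S.gen i)) = CharModule.one _ := by
    have h₁ : S.canon i (u (S.gen i)) = l (g (s₁ (S.gen i))) := LinearMap.congr_fun hr _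
    rw [h₁, S.lift_gen, map_smul, map_smul, map_smul, map_smul, CharModule.smul_def, augOp_op,
      S.aug_self, one_smul, CharModule.smul_def, ha, hc]
  have hnil : IsNilpotent (1 - u) := by
    refine isNilpotent_of_forall_comp_eq_zero (S := S) _ fun j μ => LinearMap.ext fun x => ?_
    refine S.eq_of_canon_eq μ ?_
    obtain ⟨b, rfl⟩ := S.exists_smul_gen x
    rw [map_smul, map_smul, LinearMap.sub_apply, map_sub, hu, Module.End.one_apply, canon_gen,
      sub_self, smul_zero]
  have hunit : IsUnit u := by
    have h₁ := IsNilpotent.isUnit_one_sub (R := Module.End Aᵐᵒᵖ (S.P i)) hnil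
    have h₂ : 1 - (1 - u) = u := sub_sub_cancel 1 u
    exact h₂ ▸ h₁
  obtain ⟨w, hw⟩ := hunit.exists_right_inv
  exact ⟨s₁ ∘ₗ w, r, hw, hr⟩

end VertexSystem

end VertexSystem

/-! ### The category of finitely generated projective modules -/

/-- The complement splits `𝟙 X - p.r ≫ p.i`. The equation `q.i ≫ p.r = 0` is recorded because it
makes the multiplicity drop when a summand is split off. -/
lemma exists_iso_biprod_of_retract {C : Type*} [Category* C] [Preadditive C]
    [IsIdempotentComplete C] [HasBinaryBiproducts C] {X Y : C} (p : Retract Y X) :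
    ∃ (Z : C) (q : Retract Z X) (e : X ≅ Y ⊞ Z), q.i ≫ p.r = 0 ∧ q.r ≫ q.i = 𝟙 X - p.r ≫ p.i ∧
      e.hom = biprod.lift p.r q.r ∧ e.inv = biprod.desc p.i q.i := by
  obtain ⟨Z, i, r, hir, hri⟩ := IsIdempotentComplete.idempotents_split X (𝟙 X - p.r ≫ p.i)
    (by simp)
  have h₁ : i ≫ p.r = 0 := by
    calc i ≫ p.r = i ≫ (r ≫ i) ≫ p.r := by rw [Category.assoc, reassoc_of% hir]
      _ = 0 := by rw [hri]; simp
  have h₂ : p.i ≫ r = 0 := by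
    calc p.i ≫ r = p.i ≫ (r ≫ i) ≫ r := by rw [Category.assoc, hir, Category.comp_id]
      _ = 0 := by rw [hri]; simp
  refine ⟨Z, ⟨i, r, hir⟩,
    ⟨biprod.lift p.r r, biprod.desc p.i i, ?_, ?_⟩, h₁, hri, rfl, rfl⟩
  · rw [biprod.lift_desc, hri]
    abel
  · ext <;> simp [h₁, h₂, hir]

section Proj

variable {A : Type u} [Ring A]

instance : HasFiniteProducts (Proj A) := hasFiniteProducts_of_has_binary_and_terminal

instance : HasFiniteBiproducts (Proj A) := HasFiniteBiproducts.of_hasFiniteProducts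

instance : IsIdempotentComplete (Proj A) where
  idempotents_split X p hp := by
    have h₁ := X.property.1
    have h₂ := X.property.2
    let f : X.obj →ₗ[Aᵐᵒᵖ] X.obj := p.hom.hom
    have hf : ∀ x, f (f x) = f x := fun x =>
      LinearMap.congr_fun (congrArg (fun q : X ⟶ X => q.hom.hom) hp) x
    have hfr : ∀ x : LinearMap.range f, f x.1 = x.1 := by
      rintro ⟨_, y, rfl⟩
      exact hf y
    let Y : Proj A := ⟨ModuleCat.of Aᵐᵒᵖ (LinearMap.range f),
      ⟨inferInstanceAs (Module.Finite Aᵐᵒᵖ (LinearMap.range f)),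
        Module.Projective.of_split (P := LinearMap.range f) (LinearMap.range f).subtype f.rangeRestrict
          (LinearMap.ext fun x => Subtype.ext (hfr x))⟩⟩
    refine ⟨Y, ObjectProperty.homMk (ModuleCat.ofHom (LinearMap.range f).subtype),
      ObjectProperty.homMk (ModuleCat.ofHom f.rangeRestrict), ?_, ?_⟩
    · ext x
      exact congrArg Subtype.val (Subtype.ext (hfr x) : f.rangeRestrict x.1 = x)
    · rfl

/-- The linear map underlying a morphism of projective modules. -/
abbrev Proj.lin {P Q : Proj A} (f : P ⟶ Q) : P.obj →ₗ[Aᵐᵒᵖ] Q.obj := f.hom.hom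

lemma Proj.lin_injective {P Q : Proj A} {f g : P ⟶ Q} (h : Proj.lin f = Proj.lin g) : f = g := by
  ext : 2
  exact h

/-- A linear map, as a morphism of projective modules. -/
def Proj.ofLin {P Q : Proj A} (f : P.obj →ₗ[Aᵐᵒᵖ] Q.obj) : P ⟶ Q :=
  ObjectProperty.homMk (ModuleCat.ofHom f)

lemma Proj.isZero_iff {P : Proj A} : IsZero P ↔ 𝟙 P = 0 := IsZero.iff_id_eq_zero P

namespace VertexSystem

variable {k V : Type*} [Field k] (S : VertexSystem A k V)

/-- The projective module of the vertex `i`, as an object of `Proj A`. -/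
abbrev proj (i : V) : Proj A := idempotentProj (S.e i) (S.isIdempotentElem_e i)

/-- The multiplicity of the vertex `i` in the top of `P`. -/
def mult (i : V) (P : Proj A) : ℕ := Module.finrank k (S.Top i P.obj)

/-- The canonical functional on the projective module of the vertex `i`. -/
def canonProj (i : V) : S.Top i (S.proj i).obj := S.canon i

variable {S}

instance top_finite (i : V) (P : Proj A) : Module.Finite k (S.Top i P.obj) :=
  have := P.property.1
  CharModule.finite_linearMap _

/-- Restriction of functionals along a morphism. -/
def precomp (i : V) {P Q : Proj A} (f : P ⟶ Q) : S.Top i Q.obj →ₗ[k] S.Top i P.obj where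
  toFun l := l ∘ₗ Proj.lin f
  map_add' _ _ := rfl
  map_smul' _ _ := rfl

lemma precomp_id (i : V) (P : Proj A) : precomp (S := S) i (𝟙 P) = LinearMap.id := rfl

lemma precomp_precomp (i : V) {P Q Q' : Proj A} (f : P ⟶ Q) (g : Q ⟶ Q') (l : S.Top i Q'.obj) :
    precomp i f (precomp i g l) = precomp i (f ≫ g) l := rfl

lemma precomp_zero (i : V) (P Q : Proj A) : precomp (S := S) i (0 : P ⟶ Q) = 0 := by
  ext l x
  exact map_zero l

lemma precomp_add (i : V) {P Q : Proj A} (f g : P ⟶ Q) :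
    precomp (S := S) i (f + g) = precomp i f + precomp i g := by
  ext l x
  exact map_add l _ _

lemma mult_eq_zero_iff {i : V} {P : Proj A} : S.mult i P = 0 ↔ ∀ l : S.Top i P.obj, l = 0 := by
  rw [mult, Module.finrank_zero_iff, subsingleton_iff_forall_eq 0]

lemma mult_le_of_retract {i : V} {P Q : Proj A} (r : Retract P Q) : S.mult i P ≤ S.mult i Q := by
  refine LinearMap.finrank_le_finrank_of_injective (f := precomp i r.r) ?_
  refine Function.LeftInverse.injective (g := precomp (S := S) i r.i) fun l => ?_
  rw [precomp_precomp, r.retract]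
  rfl

/-- Restriction to a retract is onto, and here `l` lies in its kernel. This drop is the induction
measure both for decomposing projectives and for minimizing complexes. -/
lemma mult_lt_of_retract {i : V} {P Q : Proj A} (r : Retract P Q) {l : S.Top i Q.obj}
    (hl : l ≠ 0) (h : precomp i r.i l = 0) : S.mult i P < S.mult i Q := by
  have hsurj : Function.Surjective (precomp (S := S) i r.i) := by
    refine Function.LeftInverse.surjective (g := precomp (S := S) i r.r) fun l => ?_
    rw [precomp_precomp, r.retract]
    rfl
  have h₁ := LinearMap.finrank_range_add_finrank_ker (precomp (S := S) i r.i)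
  rw [LinearMap.range_eq_top.2 hsurj, finrank_top] at h₁
  have h₂ : 0 < Module.finrank k (LinearMap.ker (precomp (S := S) i r.i)) := by
    refine Module.finrank_pos_iff_exists_ne_zero.2 ⟨⟨l, h⟩, fun h' => hl (congrArg Subtype.val h')⟩
  change Module.finrank k _ < Module.finrank k _
  omega

lemma mult_proj_of_ne {i j : V} (h : j ≠ i) : S.mult i (S.proj j) = 0 :=
  mult_eq_zero_iff.2 fun l => S.top_apply_gen_of_ne h l

/-- Nakayama's lemma: without functionals, the identity itself is nilpotent. -/
lemma isZero_of_forall_mult_eq_zero {P : Proj A} (h : ∀ i, S.mult i P = 0) : IsZero P := by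
  have h₁ := P.property.1
  have h₂ := P.property.2
  obtain ⟨n, hn⟩ := isNilpotent_of_forall_comp_eq_zero (S := S) (1 : Module.End Aᵐᵒᵖ P.obj)
    fun i l => by rw [mult_eq_zero_iff.1 (h i) l, LinearMap.zero_comp]
  rw [one_pow] at hn
  exact Proj.isZero_iff.2 (Proj.lin_injective hn)

/-- A morphism that is visible on the top of projective modules restricts to an isomorphism between
direct summands. -/
lemma exists_retract {P Q : Proj A} (g : P ⟶ Q) {i : V} {l : S.Top i Q.obj}
    (hl : precomp i g l ≠ 0) :
    ∃ (s : S.proj i ⟶ P) (r : Q ⟶ S.proj i), s ≫ g ≫ r = 𝟙 _ ∧ precomp i r (S.canonProj i) = l := by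
  have h₂ := Q.property.2
  obtain ⟨s, r, h, h'⟩ := S.exists_section (Proj.lin g) l hl
  exact ⟨Proj.ofLin (P := S.proj i) s, Proj.ofLin (Q := S.proj i) r, Proj.lin_injective h, h'⟩

/-- Projective modules are direct sums of the projective modules of the vertices in their top. -/
lemma proj_induction [Finite V] {J : Set V} {motive : Proj A → Prop}
    (zero : ∀ P, IsZero P → motive P)
    (step : ∀ P Q, ∀ i ∈ J, (P ≅ S.proj i ⊞ Q) → motive Q → motive P) (P : Proj A)
    (hP : ∀ i, i ∉ J → S.mult i P = 0) : motive P := by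
  have := Fintype.ofFinite V
  induction hn : ∑ i, S.mult i P using Nat.strong_induction_on generalizing P with
  | h n ih =>
    subst hn
    by_cases h : ∀ i, S.mult i P = 0
    · exact zero P (isZero_of_forall_mult_eq_zero h)
    push Not at h
    obtain ⟨i, hi⟩ := h
    have hi' : ∃ l : S.Top i P.obj, l ≠ 0 := by
      by_contra! h
      exact hi (mult_eq_zero_iff.2 h)
    obtain ⟨l, hl⟩ := hi'
    -- Applied to the identity, the splitting criterion yields the projective of the vertex `i` as a
    -- direct summand of `P`.
    obtain ⟨s, r, hsr, hr⟩ := exists_retract (𝟙 P) (l := l) hl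
    rw [Category.id_comp] at hsr
    obtain ⟨Q, q, e, hq, -, -, -⟩ := exists_iso_biprod_of_retract ⟨s, r, hsr⟩
    have hlt : ∑ j, S.mult j Q < ∑ j, S.mult j P := by
      refine Finset.sum_lt_sum (fun j _ => mult_le_of_retract q) ⟨i, Finset.mem_univ _,
        mult_lt_of_retract q hl ?_⟩
      have hq' : q.i ≫ r = 0 := hq
      rw [← hr, precomp_precomp, hq', precomp_zero, LinearMap.zero_apply]
    refine step P Q i (by_contra fun hJ => hi (hP i hJ)) e (ih _ hlt Q (fun j hj => ?_) rfl)
    exact Nat.eq_zero_of_le_zero ((mult_le_of_retract q).trans (hP j hj).le)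

end VertexSystem

end Proj

/-! ### Complexes with two terms -/

section TwoTerm

variable {C : Type*} [Category* C] [Preadditive C]

/-- The complex `K` is concentrated in the degrees `-1` and `0`. -/
def IsTwoTermComplex (K : CochainComplex C ℤ) : Prop :=
  ∀ n : ℤ, n ≠ -1 → n ≠ 0 → IsZero (K.X n)

lemma IsTwoTermComplex.of_retract {K L : CochainComplex C ℤ} (hL : IsTwoTermComplex L)
    (r : ∀ n, Nonempty (Retract (K.X n) (L.X n))) : IsTwoTermComplex K := by
  intro n h₁ h₀
  obtain ⟨r⟩ := r n
  exact (hL n h₁ h₀).of_mono r.i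

/-- A two-term complex, as an object of the bounded homotopy category. -/
def IsTwoTermComplex.toBounded {K : CochainComplex C ℤ} (hK : IsTwoTermComplex K) :
    BoundedHomotopyCategory C where
  obj := (HomotopyCategory.quotient C (.up ℤ)).obj K
  property := ⟨-1, 0, fun n hn => hK n (by omega) (by omega)⟩

lemma IsTwoTermComplex.hom_ext {K L : CochainComplex C ℤ} (hK : IsTwoTermComplex K) {f g : K ⟶ L}
    (h₁ : f.f (-1) = g.f (-1)) (h₀ : f.f 0 = g.f 0) : f = g := by
  ext n
  by_cases hn₁ : n = -1
  · subst hn₁; exact h₁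
  by_cases hn₀ : n = 0
  · subst hn₀; exact h₀
  · exact (hK n hn₁ hn₀).eq_of_src _ _

lemma exists_homotopy_of_quotient_map_eq_zero {K L : CochainComplex C ℤ} {f : K ⟶ L}
    (hf : (HomotopyCategory.quotient C (.up ℤ)).map f = 0) :
    ∃ h : ∀ i j, K.X i ⟶ L.X j,
      ∀ i, f.f i = K.d i (i + 1) ≫ h (i + 1) i + h i (i - 1) ≫ L.d (i - 1) i := by
  obtain ⟨h⟩ := (HomotopyCategory.quotient_map_eq_zero_iff f).1 hf
  refine ⟨h.hom, fun i => ?_⟩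
  rw [h.comm i, dNext_eq h.hom (show (ComplexShape.up ℤ).Rel i (i + 1) from rfl),
    prevD_eq h.hom (show (ComplexShape.up ℤ).Rel (i - 1) i from sub_add_cancel i 1)]
  simp

lemma IsTwoTermComplex.exists_of_quotient_map_eq_zero {K L : CochainComplex C ℤ}
    (hK : IsTwoTermComplex K) (hL : IsTwoTermComplex L) {f : K ⟶ L}
    (hf : (HomotopyCategory.quotient C (.up ℤ)).map f = 0) :
    ∃ h : K.X 0 ⟶ L.X (-1), f.f (-1) = K.d (-1) 0 ≫ h ∧ f.f 0 = h ≫ L.d (-1) 0 := by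
  obtain ⟨h, hh⟩ := exists_homotopy_of_quotient_map_eq_zero hf
  refine ⟨h 0 (-1), (hh (-1)).trans ?_, (hh 0).trans ?_⟩
  · rw [(hL (-1 - 1) (by omega) (by omega)).eq_of_tgt (h (-1) (-1 - 1)) 0, zero_comp, add_zero]
    rfl
  · rw [(hK (0 + 1) (by omega) (by omega)).eq_of_tgt (K.d 0 (0 + 1)) 0, zero_comp, zero_add]
    rfl

/-- The null-homotopic morphism given by a morphism from the degree `0` to the degree `-1`. -/
def nullHomotopicOf {K L : CochainComplex C ℤ} (h : K.X 0 ⟶ L.X (-1)) : K ⟶ L :=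
  Homotopy.nullHomotopicMap' fun i j _ =>
    if hij : i = 0 ∧ j = -1 then (K.XIsoOfEq hij.1).hom ≫ h ≫ (L.XIsoOfEq hij.2.symm).hom else 0

lemma nullHomotopicOf_f_neg_one {K L : CochainComplex C ℤ} (h : K.X 0 ⟶ L.X (-1)) :
    (nullHomotopicOf h).f (-1) = K.d (-1) 0 ≫ h := by
  rw [nullHomotopicOf, Homotopy.nullHomotopicMap'_f (k₂ := -2) (k₀ := 0) (by simp) (by simp)]
  simp

lemma nullHomotopicOf_f_zero {K L : CochainComplex C ℤ} (h : K.X 0 ⟶ L.X (-1)) :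
    (nullHomotopicOf h).f 0 = h ≫ L.d (-1) 0 := by
  rw [nullHomotopicOf, Homotopy.nullHomotopicMap'_f (k₂ := -1) (k₀ := 1) (by simp) (by simp)]
  simp

lemma quotient_map_nullHomotopicOf {K L : CochainComplex C ℤ} (h : K.X 0 ⟶ L.X (-1)) :
    (HomotopyCategory.quotient C (.up ℤ)).map (nullHomotopicOf h) = 0 := by
  rw [HomotopyCategory.quotient_map_eq_zero_iff]
  exact ⟨Homotopy.nullHomotopy' _⟩

/-- The morphism concentrated in degree `-1` from a two-term complex. -/
def IsTwoTermComplex.homNegOne {K L : CochainComplex C ℤ} (hK : IsTwoTermComplex K)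
    (f : K.X (-1) ⟶ L.X (-1)) (hf : f ≫ L.d (-1) 0 = 0) : K ⟶ L where
  f n := if hn : n = -1 then (K.XIsoOfEq hn).hom ≫ f ≫ (L.XIsoOfEq hn.symm).hom else 0
  comm' i j hij := by
    have hij' : i + 1 = j := hij
    subst hij'
    by_cases hi : i = -1
    · subst hi
      have h₀ : (-1 + 1 : ℤ) ≠ -1 := by omega
      rw [dif_pos rfl, dif_neg h₀, comp_zero]
      simpa using hf
    · by_cases hi' : i = 0
      · subst hi'
        rw [dif_neg (by omega), dif_neg (by omega), zero_comp, comp_zero]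
      · exact (hK i hi hi').eq_of_src _ _

lemma IsTwoTermComplex.homNegOne_f {K L : CochainComplex C ℤ} (hK : IsTwoTermComplex K)
    (f : K.X (-1) ⟶ L.X (-1)) (hf : f ≫ L.d (-1) 0 = 0) : (hK.homNegOne f hf).f (-1) = f := by
  simp [homNegOne]

/-- A rigid two-term complex `K` admits no nonzero morphism `K ⟶ K[1]` up to homotopy. -/
lemma IsTwoTermComplex.exists_of_isRigid [HasZeroObject C] {K : CochainComplex C ℤ}
    (hK : IsTwoTermComplex K)
    (h : HomShiftZero ((HomotopyCategory.quotient C (.up ℤ)).obj K)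
      ((HomotopyCategory.quotient C (.up ℤ)).obj K))
    (f : K.X (-1) ⟶ K.X 0) :
    ∃ (a : K.X 0 ⟶ K.X 0) (b : K.X (-1) ⟶ K.X (-1)),
      f = K.d (-1) 0 ≫ a + b ≫ K.d (-1) 0 := by
  let L : CochainComplex C ℤ := K⟦(1 : ℤ)⟧
  let f' : K.X (-1) ⟶ L.X (-1) := f
  -- Any morphism from degree `-1` to degree `0` is a chain map `K ⟶ K[1]`, because `K` vanishes in
  -- degree `1`.
  let F : K ⟶ L := hK.homNegOne f' ((hK (0 + 1) (by omega) (by omega)).eq_of_tgt _ _)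
  have hF : (HomotopyCategory.quotient C (.up ℤ)).map F = 0 := by
    rw [← cancel_mono (((HomotopyCategory.quotient C (.up ℤ)).commShiftIso (1 : ℤ)).hom.app K),
      zero_comp]
    exact h _
  obtain ⟨g, hg⟩ := exists_homotopy_of_quotient_map_eq_zero hF
  have h₁ : f' = _ := (hK.homNegOne_f _ _).symm.trans (hg (-1))
  have e₀ : L.X (-1) = K.X 0 := rfl
  have e₁ : L.X (-1 - 1) = K.X (-1) := rfl
  -- The shift negates the differential; the sign is moved to the second component `b` of the
  -- homotopy.
  have h₂ : L.d (-1 - 1) (-1) = -K.d (-1) 0 := by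
    change (1 : ℤ).negOnePow • K.d (-1) 0 = _
    simp
  refine ⟨cast (by rw [← e₀]) (g 0 (-1)), -cast (by rw [← e₁]) (g (-1) (-1 - 1)), h₁.trans ?_⟩
  rw [Preadditive.neg_comp, ← Preadditive.comp_neg, ← h₂]
  rfl

end TwoTerm

/-! ### Minimal two-term complexes -/

section Minimal

variable {A : Type u} [Ring A] {k V : Type*} [Field k] (S : VertexSystem A k V)

open VertexSystem

/-- The differential of the two-term complex `K` vanishes on the top. -/
def IsMinimal (K : CochainComplex (Proj A) ℤ) : Prop :=
  ∀ i (l : S.Top i (K.X 0).obj), precomp i (K.d (-1) 0) l = 0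

variable {S}

lemma quotient_obj_iso_of_split {C : Type*} [Category* C] [Preadditive C]
    {K L : CochainComplex C ℤ} {i : L ⟶ K} {r : K ⟶ L} {h : K.X 0 ⟶ K.X (-1)}
    (hir : i ≫ r = 𝟙 L) (hri : r ≫ i = 𝟙 K - nullHomotopicOf h) :
    Nonempty ((HomotopyCategory.quotient C (.up ℤ)).obj K ≅
      (HomotopyCategory.quotient C (.up ℤ)).obj L) :=
  ⟨{hom := (HomotopyCategory.quotient C (.up ℤ)).map r
    inv := (HomotopyCategory.quotient C (.up ℤ)).map i
    hom_inv_id := by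
      rw [← Functor.map_comp, hri, Functor.map_sub, quotient_map_nullHomotopicOf, sub_zero,
        CategoryTheory.Functor.map_id]
    inv_hom_id := by rw [← Functor.map_comp, hir, CategoryTheory.Functor.map_id] }⟩

/-- A functional on the degree `0` term that survives the differential exhibits a contractible
summand with both terms equal to the projective of a vertex. Splitting it off lowers the
multiplicities in degree `0`. The terms of the result are retracts of the original ones, so the
support of their tops does not grow. -/
lemma exists_isMinimal [Finite V] {K : CochainComplex (Proj A) ℤ} (hK : IsTwoTermComplex K) :
    ∃ L : CochainComplex (Proj A) ℤ, IsTwoTermComplex L ∧ IsMinimal S L ∧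
      Nonempty ((HomotopyCategory.quotient _ (.up ℤ)).obj K ≅
        (HomotopyCategory.quotient _ (.up ℤ)).obj L) ∧
      ∀ n, Nonempty (Retract (L.X n) (K.X n)) := by
  have := Fintype.ofFinite V
  induction hn : ∑ i, S.mult i (K.X 0) using Nat.strong_induction_on generalizing K with
  | h n ih =>
    subst hn
    by_cases hmin : IsMinimal S K
    · exact ⟨K, hK, hmin, ⟨Iso.refl _⟩, fun n => ⟨Retract.refl _⟩⟩
    unfold IsMinimal at hmin
    push Not at hmin
    obtain ⟨i, l, hl⟩ := hmin
    obtain ⟨s, r, hsr, hr⟩ := exists_retract (K.d (-1) 0) hl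
    -- Since `s ≫ d ≫ r = 𝟙`, this null-homotopic map is idempotent. It projects onto the
    -- contractible summand, and the complement is split off by `𝟙 K - ε`.
    let ε : K ⟶ K := nullHomotopicOf (r ≫ s)
    have hε₁ : ε.f (-1) = K.d (-1) 0 ≫ r ≫ s := nullHomotopicOf_f_neg_one _
    have hε₀ : ε.f 0 = r ≫ s ≫ K.d (-1) 0 := (nullHomotopicOf_f_zero _).trans (Category.assoc ..)
    have hsr' : ∀ {Z : Proj A} (g : S.proj i ⟶ Z), s ≫ K.d (-1) 0 ≫ r ≫ g = g := by
      intro Z g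
      rw [← Category.assoc (K.d (-1) 0), ← Category.assoc, hsr, Category.id_comp]
    have hε : ε ≫ ε = ε := by
      refine hK.hom_ext ?_ ?_
      · rw [HomologicalComplex.comp_f, hε₁]
        simp only [Category.assoc, hsr']
      · rw [HomologicalComplex.comp_f, hε₀]
        simp only [Category.assoc, hsr']
    obtain ⟨L, a, b, hab, hba⟩ := IsIdempotentComplete.idempotents_split K (𝟙 K - ε) (by simp [hε])
    have hret : ∀ n, Nonempty (Retract (L.X n) (K.X n)) := fun n =>
      ⟨⟨a.f n, b.f n, by rw [← HomologicalComplex.comp_f, hab, HomologicalComplex.id_f]⟩⟩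
    have hL : IsTwoTermComplex L := hK.of_retract hret
    have haε : a ≫ ε = 0 := by
      have h₁ : a ≫ (𝟙 K - ε) = a := by rw [← hba, ← Category.assoc, hab, Category.id_comp]
      rw [Preadditive.comp_sub, Category.comp_id, sub_eq_self] at h₁
      exact h₁
    have har : a.f 0 ≫ r = 0 := by
      have h₁ : a.f 0 ≫ ε.f 0 = 0 := by
        rw [← HomologicalComplex.comp_f, haε, HomologicalComplex.zero_f]
      have h₂ : (a.f 0 ≫ ε.f 0) ≫ r = a.f 0 ≫ r := by
        rw [hε₀]
        simp only [Category.assoc]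
        rw [hsr, Category.comp_id]
      rw [← h₂, h₁, zero_comp]
    have hl₀ : l ≠ 0 := by
      rintro rfl
      exact hl (map_zero _)
    have hlt : ∑ j, S.mult j (L.X 0) < ∑ j, S.mult j (K.X 0) := by
      let q : Retract (L.X 0) (K.X 0) := ⟨a.f 0, b.f 0, by
        rw [← HomologicalComplex.comp_f, hab, HomologicalComplex.id_f]⟩
      refine Finset.sum_lt_sum (fun j _ => mult_le_of_retract q) ⟨i, Finset.mem_univ _,
        mult_lt_of_retract q hl₀ ?_⟩
      change precomp i (a.f 0) l = 0
      rw [← hr, precomp_precomp, har, precomp_zero, LinearMap.zero_apply]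
    obtain ⟨M, hM, hmin, ⟨e⟩, hret'⟩ := ih _ hlt hL rfl
    obtain ⟨e'⟩ := quotient_obj_iso_of_split hab hba
    exact ⟨M, hM, hmin, ⟨e'.trans e⟩, fun n => ⟨(hret' n).some.trans (hret n).some⟩⟩

lemma isNilpotent_of_precomp_eq_zero {P : Proj A} (f : P ⟶ P)
    (hf : ∀ i (l : S.Top i P.obj), precomp i f l = 0) : ∃ n, (End.of f) ^ n = 0 := by
  have h₁ := P.property.1
  have h₂ := P.property.2
  obtain ⟨n, hn⟩ := isNilpotent_of_forall_comp_eq_zero (S := S) (Proj.lin f) hf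
  have key : ∀ m, Proj.lin (End.asHom (End.of f ^ m)) = (Proj.lin f : Module.End Aᵐᵒᵖ P.obj) ^ m := by
    intro m
    induction m with
    | zero => rfl
    | succ m ih => rw [pow_succ, pow_succ, ← ih]; rfl
  exact ⟨n, Proj.lin_injective ((key n).trans hn)⟩

/-- A null-homotopic endomorphism factors through the differential in both degrees. By minimality it
vanishes on tops, hence is nilpotent degreewise. -/
lemma IsMinimal.isNilpotent {K : CochainComplex (Proj A) ℤ} (hK : IsTwoTermComplex K)
    (hmin : IsMinimal S K) (f : End K)
    (hf : (HomotopyCategory.quotient _ (.up ℤ)).map (End.asHom f) = 0) : IsNilpotent f := by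
  obtain ⟨h, h₁, h₀⟩ := hK.exists_of_quotient_map_eq_zero hK hf
  obtain ⟨n₁, hn₁⟩ := isNilpotent_of_precomp_eq_zero (S := S) ((End.asHom f).f (-1)) fun i l => by
    rw [h₁, ← precomp_precomp, hmin]
  obtain ⟨n₀, hn₀⟩ := isNilpotent_of_precomp_eq_zero (S := S) ((End.asHom f).f 0) fun i l => by
    rw [h₀, ← precomp_precomp, hmin, map_zero]
  have key : ∀ (j : ℤ) m, (End.asHom (X := K) (f ^ m)).f j = End.asHom (End.of ((End.asHom f).f j) ^ m) := by
    intro j m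
    induction m with
    | zero => rfl
    | succ m ih => rw [pow_succ, pow_succ]; exact congrArg ((End.asHom f).f j ≫ ·) ih
  refine ⟨n₁ + n₀, hK.hom_ext ((key _ _).trans ?_) ((key _ _).trans ?_)⟩
  · rw [pow_add, hn₁, zero_mul]
    rfl
  · rw [pow_add, hn₀, mul_zero]
    rfl

/-- Direct summands of two-term complexes in the homotopy category are two-term complexes. -/
lemma exists_isTwoTermComplex_of_retract (S : VertexSystem A k V) [Finite V]
    {K : CochainComplex (Proj A) ℤ}
    (hK : IsTwoTermComplex K) {Z : HomotopyCategory (Proj A) (.up ℤ)}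
    (p : Retract Z ((HomotopyCategory.quotient _ (.up ℤ)).obj K)) :
    ∃ L : CochainComplex (Proj A) ℤ, IsTwoTermComplex L ∧
      Nonempty (Z ≅ (HomotopyCategory.quotient _ (.up ℤ)).obj L) ∧
      ∀ n, Nonempty (Retract (L.X n) (K.X n)) := by
  obtain ⟨K', hK', hmin, ⟨e⟩, hret⟩ := exists_isMinimal (S := S) hK
  let q : Retract Z ((HomotopyCategory.quotient _ (.up ℤ)).obj K') := p.trans e.retract
  let φ : End K' →+* End ((HomotopyCategory.quotient (Proj A) (.up ℤ)).obj K') :=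
    { Functor.mapEnd K' (HomotopyCategory.quotient (Proj A) (.up ℤ)) with
      map_zero' := (HomotopyCategory.quotient (Proj A) (.up ℤ)).map_zero K' K'
      map_add' := fun a b => (HomotopyCategory.quotient (Proj A) (.up ℤ)).map_add
        (f := End.asHom a) (g := End.asHom b) }
  -- By minimality the kernel of `φ` is nil, so the idempotent up to homotopy lifts to an idempotent
  -- chain map, which splits in the category of complexes.
  obtain ⟨ε, hε, hφ⟩ := exists_isIdempotentElem_eq_of_ker_isNilpotent φ
    (fun f hf => hmin.isNilpotent hK' f hf) (End.of (q.r ≫ q.i))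
    ((HomotopyCategory.quotient (Proj A) (.up ℤ)).map_surjective _)
    (show (q.r ≫ q.i) ≫ (q.r ≫ q.i) = q.r ≫ q.i by simp)
  obtain ⟨L, a, b, hab, hba⟩ := IsIdempotentComplete.idempotents_split K' (End.asHom ε) hε
  have hret' : ∀ n, Nonempty (Retract (L.X n) (K'.X n)) := fun n =>
    ⟨⟨a.f n, b.f n, by rw [← HomologicalComplex.comp_f, hab, HomologicalComplex.id_f]⟩⟩
  have hφ' : (HomotopyCategory.quotient (Proj A) (.up ℤ)).map (b ≫ a) = q.r ≫ q.i := by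
    rw [hba]; exact hφ
  rw [Functor.map_comp] at hφ'
  have hab' : (HomotopyCategory.quotient (Proj A) (.up ℤ)).map a ≫
      (HomotopyCategory.quotient (Proj A) (.up ℤ)).map b = 𝟙 _ := by
    rw [← Functor.map_comp, hab, CategoryTheory.Functor.map_id]
  refine ⟨L, hK'.of_retract hret', ⟨
    { hom := q.i ≫ (HomotopyCategory.quotient (Proj A) (.up ℤ)).map b
      inv := (HomotopyCategory.quotient (Proj A) (.up ℤ)).map a ≫ q.r
      hom_inv_id := ?_
      inv_hom_id := ?_ }⟩, fun n => ⟨(hret' n).some.trans (hret n).some⟩⟩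
  · simp only [Category.assoc]
    rw [reassoc_of% hφ', q.retract_assoc, q.retract]
  · simp only [Category.assoc]
    rw [← reassoc_of% hφ', hab', Category.comp_id, hab']

/-- The two terms of a minimal rigid complex have no common direct summand. -/
lemma IsMinimal.mult_eq_zero {K : CochainComplex (Proj A) ℤ} (hK : IsTwoTermComplex K)
    (hmin : IsMinimal S K)
    (hrig : HomShiftZero ((HomotopyCategory.quotient _ (.up ℤ)).obj K)
      ((HomotopyCategory.quotient _ (.up ℤ)).obj K)) (i : V) :
    S.mult i (K.X (-1)) = 0 ∨ S.mult i (K.X 0) = 0 := by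
  by_contra! h
  obtain ⟨h₁, h₀⟩ := h
  rw [Ne, mult_eq_zero_iff] at h₁ h₀
  push Not at h₁ h₀
  obtain ⟨μ, hμ⟩ := h₁
  obtain ⟨l, hl⟩ := h₀
  obtain ⟨s, r, hsr, hr⟩ := exists_retract (𝟙 (K.X 0)) (l := l) hl
  obtain ⟨-, r', -, hr'⟩ := exists_retract (𝟙 (K.X (-1))) (l := μ) hμ
  rw [Category.id_comp] at hsr
  -- The map `r' ≫ s` passes from degree `-1` to degree `0` through the common summand and pulls `l`
  -- back to `μ ≠ 0`. Rigidity writes it as a sum of two maps factoring through the differential,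
  -- which pull every functional back to zero.
  obtain ⟨a, b, hab⟩ := hK.exists_of_isRigid hrig (r' ≫ s)
  apply hμ
  calc μ = precomp i ((r' ≫ s) ≫ r) (S.canonProj i) := by
        rw [Category.assoc, hsr, Category.comp_id, hr']
    _ = precomp i (r' ≫ s) l := by rw [← hr, precomp_precomp]
    _ = 0 := by
        rw [hab, precomp_add, LinearMap.add_apply, ← precomp_precomp, ← precomp_precomp,
          hmin i l, hmin i, map_zero, add_zero]

end Minimal

/-! ### Euler characteristics -/

section EulerCharacteristic

variable {A : Type u} [Ring A] {k V : Type*} [Field k] (S : VertexSystem A k V)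

namespace VertexSystem

lemma mult_eq_of_iso (i : V) {P Q : Proj A} (e : P ≅ Q) : S.mult i P = S.mult i Q :=
  le_antisymm (mult_le_of_retract e.retract) (mult_le_of_retract e.symm.retract)

lemma mult_of_isZero (i : V) {P : Proj A} (h : IsZero P) : S.mult i P = 0 := by
  refine mult_eq_zero_iff.2 fun l => ?_
  change precomp i (𝟙 P) l = 0
  rw [h.eq_of_src (𝟙 P) 0, precomp_zero, LinearMap.zero_apply]

lemma mult_biprod (i : V) (P Q : Proj A) : S.mult i (P ⊞ Q) = S.mult i P + S.mult i Q := by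
  rw [mult, mult, mult, ← Module.finrank_prod]
  refine LinearEquiv.finrank_eq (LinearEquiv.ofLinearMap
    ((precomp i biprod.inl).prod (precomp i biprod.inr))
    ((precomp i biprod.fst).coprod (precomp i biprod.snd)) ?_ ?_)
  · refine LinearMap.ext fun x => Prod.ext ?_ ?_
    · change precomp i biprod.inl (precomp i biprod.fst x.1 + precomp i biprod.snd x.2) = x.1
      rw [map_add, precomp_precomp, precomp_precomp, biprod.inl_fst, biprod.inl_snd, precomp_zero,
        precomp_id]
      simp
    · change precomp i biprod.inr (precomp i biprod.fst x.1 + precomp i biprod.snd x.2) = x.2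
      rw [map_add, precomp_precomp, precomp_precomp, biprod.inr_fst, biprod.inr_snd, precomp_zero,
        precomp_id]
      simp
  · refine LinearMap.ext fun l => ?_
    change precomp i biprod.fst (precomp i biprod.inl l) +
      precomp i biprod.snd (precomp i biprod.inr l) = l
    rw [precomp_precomp, precomp_precomp, ← LinearMap.add_apply, ← precomp_add, biprod.total]
    rfl

/-- The alternating sum of the multiplicities of the vertex `i` in the terms of a complex. -/
def eulerChar (i : V) (K : CochainComplex (Proj A) ℤ) : ℤ :=
  ∑ᶠ n : ℤ, (n.negOnePow : ℤ) * S.mult i (K.X n)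

/-- The complex `K` is bounded. -/
def IsBoundedComplex (K : CochainComplex (Proj A) ℤ) : Prop :=
  ∃ a b : ℤ, ∀ n : ℤ, (n < a ∨ b < n) → IsZero (K.X n)

lemma hasFiniteSupport_of_bounds {f : ℤ → ℤ} {a b : ℤ}
    (h : ∀ n : ℤ, (n < a ∨ b < n) → f n = 0) : Function.HasFiniteSupport f := by
  refine (Set.finite_Icc a b).subset fun n hn => ?_
  by_contra hn'
  rw [Set.mem_Icc, not_and_or, not_le, not_le] at hn'
  exact hn (h n hn')

/-- Reindexing the second summand by one reverses its sign, so the sum telescopes; boundedness makes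
both sums finite. -/
lemma finsum_negOnePow_add_shift {f : ℤ → ℤ} {a b : ℤ}
    (h : ∀ n : ℤ, (n < a ∨ b < n) → f n = 0) :
    ∑ᶠ n : ℤ, (n.negOnePow : ℤ) * (f n + f (n - 1)) = 0 := by
  have h₁ : ∑ᶠ n : ℤ, (n.negOnePow : ℤ) * f (n - 1) = -∑ᶠ n : ℤ, (n.negOnePow : ℤ) * f n := by
    rw [← finsum_neg_distrib, ← finsum_comp_equiv (Equiv.addRight (1 : ℤ))]
    refine finsum_congr fun n => ?_
    simp [Int.negOnePow_succ]
  simp only [mul_add]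
  rw [finsum_add_distrib, h₁, add_neg_cancel]
  · exact hasFiniteSupport_of_bounds (a := a) (b := b) fun n hn => by rw [h n hn, mul_zero]
  · exact hasFiniteSupport_of_bounds (a := a) (b := b + 1) fun n hn => by
      rw [h (n - 1) (by omega), mul_zero]

/-- A contracting homotopy of `K` also contracts the complex of functionals, which is therefore
exact. By rank and nullity each multiplicity is the sum of two consecutive ranks, and the
alternating sum telescopes. -/
lemma eulerChar_eq_zero (i : V) {K : CochainComplex (Proj A) ℤ} (hK : IsBoundedComplex K)
    (h : IsZero ((HomotopyCategory.quotient _ (.up ℤ)).obj K)) : S.eulerChar i K = 0 := by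
  obtain ⟨a, b, hab⟩ := hK
  obtain ⟨s, hs⟩ := exists_homotopy_of_quotient_map_eq_zero (f := 𝟙 K) (h.eq_of_src _ _)
  let δ (n : ℤ) : S.Top i (K.X (n + 1)).obj →ₗ[k] S.Top i (K.X n).obj := precomp i (K.d n (n + 1))
  let ρ (n : ℤ) : ℕ := Module.finrank k (LinearMap.range (δ n))
  have hker : ∀ n, LinearMap.ker (δ n) = LinearMap.range (δ (n + 1)) := by
    intro n
    ext l
    constructor
    · intro hl
      have hl' : precomp i (K.d n (n + 1)) l = 0 := hl
      refine ⟨precomp i (s (n + 1 + 1) (n + 1)) l, ?_⟩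
      have h₁ : precomp i (𝟙 (K.X (n + 1))) l = l := rfl
      have h₂ := hs (n + 1)
      rw [HomologicalComplex.id_f] at h₂
      have h₃ : n + 1 - 1 = n := by omega
      rw [h₃] at h₂
      rw [h₂, precomp_add, LinearMap.add_apply, ← precomp_precomp, ← precomp_precomp, hl', map_zero,
        add_zero] at h₁
      exact h₁
    · rintro ⟨l, rfl⟩
      change precomp i _ (precomp i _ l) = 0
      rw [precomp_precomp, K.d_comp_d, precomp_zero, LinearMap.zero_apply]
  have hmult : ∀ n, (S.mult i (K.X n) : ℤ) = ρ n + ρ (n - 1) := by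
    intro n
    obtain ⟨m, rfl⟩ : ∃ m, n = m + 1 := ⟨n - 1, by omega⟩
    have h₁ := LinearMap.finrank_range_add_finrank_ker (δ m)
    rw [hker m] at h₁
    rw [show m + 1 - 1 = m by omega]
    change ρ m + ρ (m + 1) = S.mult i (K.X (m + 1)) at h₁
    rw [← h₁]
    push_cast
    ring
  have hρ : ∀ n, (n < a ∨ b < n) → (ρ n : ℤ) = 0 := by
    intro n hn
    have h₁ : ρ n ≤ S.mult i (K.X n) := Submodule.finrank_le _
    rw [S.mult_of_isZero i (hab n hn)] at h₁
    omega
  rw [eulerChar]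
  simp only [hmult]
  exact finsum_negOnePow_add_shift (f := fun n => (ρ n : ℤ)) hρ

lemma eulerChar_mappingCone (i : V) {K L : CochainComplex (Proj A) ℤ} (hK : IsBoundedComplex K)
    (hL : IsBoundedComplex L) (f : K ⟶ L) :
    S.eulerChar i (CochainComplex.mappingCone f) = S.eulerChar i L - S.eulerChar i K := by
  obtain ⟨a, b, hab⟩ := hK
  obtain ⟨a', b', hab'⟩ := hL
  have h₁ : ∀ n : ℤ, S.mult i ((CochainComplex.mappingCone f).X n) =
      S.mult i (K.X (n + 1)) + S.mult i (L.X n) := fun n =>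
    (S.mult_eq_of_iso i (HomologicalComplex.homotopyCofiber.XIsoBiprod f n (n + 1) rfl)).trans
      (S.mult_biprod i _ _)
  have h₂ : S.eulerChar i K = ∑ᶠ n : ℤ, -((n.negOnePow : ℤ) * S.mult i (K.X (n + 1))) := by
    rw [eulerChar, ← finsum_comp_equiv (Equiv.addRight (1 : ℤ))]
    refine finsum_congr fun n => ?_
    simp [Int.negOnePow_succ]
  rw [h₂, finsum_neg_distrib, sub_neg_eq_add, eulerChar, eulerChar, ← finsum_add_distrib]
  · refine finsum_congr fun n => ?_
    rw [h₁]
    push_cast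
    ring
  · exact hasFiniteSupport_of_bounds (a := a') (b := b') fun n hn => by
      rw [S.mult_of_isZero i (hab' n hn), Nat.cast_zero, mul_zero]
  · exact hasFiniteSupport_of_bounds (a := a - 1) (b := b) fun n hn => by
      rw [S.mult_of_isZero i (hab (n + 1) (by omega)), Nat.cast_zero, mul_zero]

lemma isBoundedComplex_mappingCone {K L : CochainComplex (Proj A) ℤ} (hK : IsBoundedComplex K)
    (hL : IsBoundedComplex L) (f : K ⟶ L) : IsBoundedComplex (CochainComplex.mappingCone f) := by
  obtain ⟨a, b, hab⟩ := hK
  obtain ⟨a', b', hab'⟩ := hL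
  exact ⟨min (a - 1) a', max b b', fun n hn => (CochainComplex.mappingCone.isZero_X_iff f n).2
    ⟨hab (n + 1) (by omega), hab' n (by omega)⟩⟩

/-- The cone of a chain map representing the isomorphism is zero in the homotopy category, so its
alternating sum, the difference of the two sides, vanishes. -/
lemma eulerChar_eq_of_iso (i : V) {K L : CochainComplex (Proj A) ℤ} (hK : IsBoundedComplex K)
    (hL : IsBoundedComplex L)
    (e : (HomotopyCategory.quotient _ (.up ℤ)).obj K ≅
      (HomotopyCategory.quotient _ (.up ℤ)).obj L) :
    S.eulerChar i K = S.eulerChar i L := by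
  obtain ⟨f, hf⟩ := (HomotopyCategory.quotient (Proj A) (.up ℤ)).map_surjective e.hom
  have hT := HomotopyCategory.mappingCone_triangleh_distinguished f
  have h₁ : IsIso (CochainComplex.mappingCone.triangleh f).mor₁ := by
    change IsIso ((HomotopyCategory.quotient (Proj A) (.up ℤ)).map f)
    rw [hf]
    infer_instance
  have h₂ := (Triangle.isZero₃_iff_isIso₁ _ hT).2 h₁
  have h₃ := S.eulerChar_mappingCone i hK hL f
  rw [S.eulerChar_eq_zero i (isBoundedComplex_mappingCone hK hL f) h₂] at h₃
  omega

lemma eulerChar_obj₂ (i : V) (T : Triangle (KbProj A)) (hT : T ∈ distTriang (KbProj A)) :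
    S.eulerChar i T.obj₂.obj.as =
      S.eulerChar i T.obj₁.obj.as + S.eulerChar i T.obj₃.obj.as := by
  have hT' : (bounded (Proj A)).ι.mapTriangle.obj T ∈
    distTriang (HomotopyCategory (Proj A) (.up ℤ)) := hT
  obtain ⟨f : T.obj₁.obj.as ⟶ T.obj₂.obj.as, hf⟩ :=
    (HomotopyCategory.quotient (Proj A) (.up ℤ)).map_surjective T.mor₁.hom
  have e : T.obj₃.obj ≅
      (HomotopyCategory.quotient (Proj A) (.up ℤ)).obj (CochainComplex.mappingCone f) :=
    Triangle.π₃.mapIso (isoTriangleOfIso₁₂ _ _ hT'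
      (HomotopyCategory.mappingCone_triangleh_distinguished f) (Iso.refl _) (Iso.refl _)
      ((Category.comp_id _).trans (hf.symm.trans (Category.id_comp _).symm)))
  have h₁ := S.eulerChar_eq_of_iso i (K := T.obj₃.obj.as) T.obj₃.property
    (isBoundedComplex_mappingCone T.obj₁.property T.obj₂.property f) e
  have h₂ := S.eulerChar_mappingCone i T.obj₁.property T.obj₂.property f
  omega

/-- The coordinate of the vertex `i` on the Grothendieck group. -/
def coordinate (i : V) : K0 (KbProj A) →+ ℤ :=
  QuotientAddGroup.lift _ (FreeAbelianGroup.lift fun X : KbProj A => S.eulerChar i X.obj.as) (by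
    rw [AddSubgroup.closure_le]
    rintro _ ⟨T, hT, rfl⟩
    simp only [SetLike.mem_coe, AddMonoidHom.mem_ker, map_sub, map_add,
      FreeAbelianGroup.lift_apply_of]
    rw [S.eulerChar_obj₂ i T hT, sub_self])

lemma coordinate_of (i : V) (X : KbProj A) :
    S.coordinate i (K0.of X) = S.eulerChar i X.obj.as :=
  FreeAbelianGroup.lift_apply_of _ _

lemma eulerChar_twoTerm (i : V) {K : CochainComplex (Proj A) ℤ} (hK : IsTwoTermComplex K) :
    S.eulerChar i K = S.mult i (K.X 0) - S.mult i (K.X (-1)) := by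
  rw [eulerChar, finsum_eq_sum_of_support_subset (s := {0, -1})]
  · rw [Finset.sum_pair (by omega)]
    simp [sub_eq_add_neg]
  · intro n hn
    by_contra h
    simp only [Finset.coe_insert, Finset.coe_singleton, Set.mem_insert_iff,
      Set.mem_singleton_iff, not_or] at h
    refine hn ?_
    change (n.negOnePow : ℤ) * S.mult i (K.X n) = 0
    rw [S.mult_of_isZero i (hK n h.2 h.1), Nat.cast_zero, mul_zero]

lemma coordinate_inDegreeZero (i : V) (P : Proj A) :
    S.coordinate i (K0.of (inDegreeZero P)) = S.mult i P := by
  rw [coordinate_of, S.eulerChar_twoTerm i (K := (inDegreeZero P).obj.as) fun n _ h₀ =>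
    HomologicalComplex.isZero_single_obj_X (.up ℤ) 0 P n h₀]
  have h₁ : S.mult i ((inDegreeZero P).obj.as.X (-1)) = 0 :=
    S.mult_of_isZero i (HomologicalComplex.isZero_single_obj_X (.up ℤ) 0 P (-1) (by omega))
  have h₂ : S.mult i ((inDegreeZero P).obj.as.X 0) = S.mult i P :=
    S.mult_eq_of_iso i (HomologicalComplex.singleObjXSelf (.up ℤ) 0 P)
  rw [h₁, h₂]
  simp

lemma coordinate_eq_zero_of_mem {V : Type u} (S : VertexSystem A k V) {J : Finset V} {i : V} (hi : i ∉ J) {x : K0 (KbProj A)}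
    (hx : x ∈ coordinateSubspace S.e S.isIdempotentElem_e J) : S.coordinate i x = 0 := by
  have h : coordinateSubspace S.e S.isIdempotentElem_e J ≤ (S.coordinate i).ker := by
    refine (AddSubgroup.closure_le _).2 ?_
    rintro _ ⟨j, hj, rfl⟩
    refine (S.coordinate_inDegreeZero i (S.proj j)).trans ?_
    rw [mult_proj_of_ne (ne_of_mem_of_not_mem hj hi)]
    rfl
  exact h hx

end VertexSystem

end EulerCharacteristic

/-! ### Classes in the Grothendieck group -/

section Classes

variable {C : Type*} [Category* C] [Preadditive C] [HasZeroObject C] [HasBinaryBiproducts C]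

open HomologicalComplex

/-- Relations may be read off from triangles of the unbounded homotopy category: completing the
first morphism inside the bounded one gives a third object isomorphic to the given one. -/
lemma K0.of_distinguished {T : Triangle (HomotopyCategory C (.up ℤ))}
    (hT : T ∈ distTriang (HomotopyCategory C (.up ℤ))) (X₁ X₂ X₃ : BoundedHomotopyCategory C)
    (e₁ : X₁.obj ≅ T.obj₁) (e₂ : X₂.obj ≅ T.obj₂) (e₃ : X₃.obj ≅ T.obj₃) :
    K0.of X₂ = K0.of X₁ + K0.of X₃ := by
  let f : X₁ ⟶ X₂ := ObjectProperty.homMk (e₁.hom ≫ T.mor₁ ≫ e₂.inv)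
  obtain ⟨Z, g, h, hZ⟩ := distinguished_cocone_triangle f
  have hZ' : (bounded C).ι.mapTriangle.obj (Triangle.mk f g h) ∈
    distTriang (HomotopyCategory C (.up ℤ)) := hZ
  have e : Z.obj ≅ T.obj₃ := Triangle.π₃.mapIso (isoTriangleOfIso₁₂ _ _ hZ' hT e₁ e₂ (by
    change (e₁.hom ≫ T.mor₁ ≫ e₂.inv) ≫ e₂.hom = e₁.hom ≫ T.mor₁
    simp))
  rw [K0.of_eq_of_iso ((bounded C).isoMk (e₃.trans e.symm) : X₃ ≅ Z)]
  exact K0.of_obj₂ _ hZ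

lemma K0.of_degreewiseSplit (S : ShortComplex (CochainComplex C ℤ))
    (σ : ∀ n, (S.map (eval C _ n)).Splitting) (X₁ X₂ X₃ : BoundedHomotopyCategory C)
    (e₁ : X₁.obj ≅ (HomotopyCategory.quotient C (.up ℤ)).obj S.X₁)
    (e₂ : X₂.obj ≅ (HomotopyCategory.quotient C (.up ℤ)).obj S.X₂)
    (e₃ : X₃.obj ≅ (HomotopyCategory.quotient C (.up ℤ)).obj S.X₃) :
    K0.of X₂ = K0.of X₁ + K0.of X₃ :=
  K0.of_distinguished (T := CochainComplex.trianglehOfDegreewiseSplit S σ)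
    ((HomotopyCategory.distinguished_iff_iso_trianglehOfDegreewiseSplit _).2
      ⟨S, σ, ⟨Iso.refl _⟩⟩) X₁ X₂ X₃ e₁ e₂ e₃

lemma K0.of_inDegreeZero_of_iso_biprod {P Q Q' : C} (e : P ≅ Q ⊞ Q') :
    K0.of (inDegreeZero P) = K0.of (inDegreeZero Q) + K0.of (inDegreeZero Q') := by
  let S₀ : ShortComplex C := ShortComplex.mk (biprod.inl : Q ⟶ Q ⊞ Q') biprod.snd (by simp)
  let σ₀ : S₀.Splitting := { r := biprod.fst, s := biprod.inr }
  exact K0.of_degreewiseSplit (S₀.map (single C (.up ℤ) 0))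
    (fun n => (σ₀.map (single C (.up ℤ) 0)).map (eval C _ n)) _ _ _ (Iso.refl _)
    ((single C (.up ℤ) 0 ⋙ HomotopyCategory.quotient C (.up ℤ)).mapIso e) (Iso.refl _)

/-- A zero object satisfies `P ≅ P ⊞ P`, so its class `x` satisfies `x = x + x`. -/
lemma K0.of_inDegreeZero_of_isZero {P : C} (h : IsZero P) : K0.of (inDegreeZero P) = 0 := by
  have e : P ≅ P ⊞ P :=
    ⟨biprod.inl, biprod.fst, by simp, by ext <;> exact h.eq_of_src _ _⟩
  simpa using K0.of_inDegreeZero_of_iso_biprod e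

lemma K0.of_shift {T : Type*} [Category* T] [Preadditive T] [HasZeroObject T] [HasShift T ℤ]
    [∀ n : ℤ, (shiftFunctor T n).Additive] [Pretriangulated T] (X : T) :
    K0.of (X⟦(1 : ℤ)⟧) = -K0.of X := by
  have h₀ : K0.of (0 : T) = 0 := by
    have h := K0.of_obj₂ _ (contractible_distinguished (0 : T))
    simpa using h
  have h := K0.of_obj₂ _ (rot_of_distTriang _ (contractible_distinguished X))
  change K0.of (0 : T) = K0.of X + K0.of (X⟦(1 : ℤ)⟧) at h
  rw [h₀] at h
  exact (neg_eq_of_add_eq_zero_right h.symm).symm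

/-- The class of a two-term complex. -/
lemma K0.of_twoTerm (X : BoundedHomotopyCategory C) (hX : IsTwoTerm X) :
    K0.of X = K0.of (inDegreeZero (X.obj.as.X 0)) - K0.of (inDegreeZero (X.obj.as.X (-1))) := by
  let K : CochainComplex C ℤ := X.obj.as
  -- The term in degree `0` is a subcomplex with quotient the term in degree `-1`, and the sequence
  -- splits in each degree. The quotient is a shift of an object in degree `0`, whence the minus
  -- sign.
  let f : (single C (.up ℤ) 0).obj (K.X 0) ⟶ K := mkHomFromSingle (𝟙 _) fun m hm =>
    (hX m (by have : 0 + 1 = m := hm; omega) (by have : 0 + 1 = m := hm; omega)).eq_of_tgt _ _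
  let g : K ⟶ (single C (.up ℤ) (-1)).obj (K.X (-1)) := mkHomToSingle (𝟙 _) fun m hm =>
    (hX m (by have : m + 1 = -1 := hm; omega) (by have : m + 1 = -1 := hm; omega)).eq_of_src _ _
  let S : ShortComplex (CochainComplex C ℤ) := ShortComplex.mk f g (by
    refine HomologicalComplex.hom_ext _ _ fun n => ?_
    by_cases h : n = 0
    · subst h
      exact (isZero_single_obj_X (.up ℤ) (-1) _ 0 (by omega)).eq_of_tgt _ _
    · exact (isZero_single_obj_X (.up ℤ) 0 _ n h).eq_of_src _ _)
  have σ : ∀ n, (S.map (eval C _ n)).Splitting := by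
    intro n
    by_cases h₀ : n = 0
    · subst h₀
      refine ShortComplex.Splitting.ofIsIsoOfIsZero _ ?_
        (isZero_single_obj_X (.up ℤ) (-1) (K.X (-1)) 0 (by omega) :)
      change IsIso (f.f 0)
      rw [mkHomFromSingle_f]
      infer_instance
    · refine ShortComplex.Splitting.ofIsZeroOfIsIso _ (isZero_single_obj_X (.up ℤ) 0 _ n h₀) ?_
      change IsIso (g.f n)
      by_cases h₁ : n = -1
      · subst h₁
        rw [mkHomToSingle_f]
        infer_instance
      · exact ⟨0, (hX n h₁ h₀).eq_of_src _ _,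
          (isZero_single_obj_X (.up ℤ) (-1) _ n h₁).eq_of_src _ _⟩
  have h := K0.of_degreewiseSplit S σ (inDegreeZero (K.X 0)) X
    ((inDegreeZero (K.X (-1)))⟦(1 : ℤ)⟧) (Iso.refl _) (Iso.refl _)
    (((bounded C).ι.commShiftIso (1 : ℤ)).app (inDegreeZero (K.X (-1))) ≪≫
      (((HomotopyCategory.singleFunctors C).shiftIso 1 (-1) 0 (by omega)).app (K.X (-1)) :))
  rw [h, K0.of_shift, sub_eq_add_neg]

end Classes

/-! ### Projective modules supported on a set of vertices and the coordinate subspace -/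

section Coordinates

variable {A : Type u} [Ring A] {k : Type*} {V : Type u} [Field k] (S : VertexSystem A k V)

namespace VertexSystem

/-- The class of a projective module is in the coordinate subspace of the vertices of its top. -/
lemma of_inDegreeZero_mem_coordinateSubspace [Finite V] {J : Finset V} {P : Proj A}
    (hP : ∀ i ∉ J, S.mult i P = 0) :
    K0.of (inDegreeZero P) ∈ coordinateSubspace S.e S.isIdempotentElem_e J := by
  refine proj_induction (S := S) (J := J)
    (motive := fun P => K0.of (inDegreeZero P) ∈ coordinateSubspace S.e S.isIdempotentElem_e J)
    (fun P h => ?_) (fun P Q i hi e hQ => ?_) P (fun i hi => hP i hi)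
  · rw [K0.of_inDegreeZero_of_isZero h]
    exact zero_mem _
  · rw [K0.of_inDegreeZero_of_iso_biprod e]
    exact add_mem (AddSubgroup.subset_closure ⟨i, hi, rfl⟩) hQ

end VertexSystem

end Coordinates

/-! ### Transport along fully faithful functors -/

section Transport

lemma homShiftZero_map_iff {T T' : Type*} [Category* T] [Preadditive T] [HasShift T ℤ]
    [Category* T'] [Preadditive T'] [HasShift T' ℤ] (F : T ⥤ T') [F.Full] [F.Faithful]
    [F.Additive] [F.CommShift ℤ] (X Y : T) :
    HomShiftZero (F.obj X) (F.obj Y) ↔ HomShiftZero X Y := by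
  constructor
  · intro h f
    apply F.map_injective
    rw [F.map_zero, ← cancel_mono ((F.commShiftIso (1 : ℤ)).hom.app Y), zero_comp]
    exact h _
  · intro h f
    obtain ⟨g, hg⟩ := F.map_surjective (f ≫ (F.commShiftIso (1 : ℤ)).inv.app Y)
    rw [h g, F.map_zero] at hg
    rw [← cancel_mono ((F.commShiftIso (1 : ℤ)).inv.app Y), ← hg, zero_comp]

lemma isZero_of_isZero_map {C D : Type*} [Category* C] [Preadditive C] [Category* D]
    [Preadditive D] (F : C ⥤ D) [F.Faithful] [F.Additive] {X : C} (h : IsZero (F.obj X)) :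
    IsZero X := by
  rw [IsZero.iff_id_eq_zero]
  exact F.map_injective (h.eq_of_src _ _)

variable {C D : Type*} [Category* C] [Preadditive C] [Category* D] [Preadditive D] (F : C ⥤ D)
  [F.Additive]

/-- Complexes lift along fully faithful functors. -/
lemma exists_mapHomologicalComplex_iso [F.Full] [F.Faithful] {ι : Type*} {c : ComplexShape ι} (K : HomologicalComplex D c)
    (h : ∀ n, F.essImage (K.X n)) :
    ∃ L : HomologicalComplex C c, Nonempty ((F.mapHomologicalComplex c).obj L ≅ K) := by
  choose X e using h
  let e' n := (e n).some
  let L : HomologicalComplex C c :=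
    { X := X
      d := fun i j => F.preimage ((e' i).hom ≫ K.d i j ≫ (e' j).inv)
      shape := fun i j hij => F.map_injective (by
        rw [F.map_preimage, K.shape i j hij, zero_comp, comp_zero, F.map_zero])
      d_comp_d' := fun i j l _ _ => F.map_injective (by simp) }
  exact ⟨L, ⟨HomologicalComplex.Hom.isoOfComponents e' fun i j _ => by
    have h : (e' i).hom ≫ K.d i j =
      F.map (F.preimage ((e' i).hom ≫ K.d i j ≫ (e' j).inv)) ≫ (e' j).hom := by simp
    exact h⟩⟩

/-- The functor between bounded homotopy categories induced by an additive functor. -/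
def boundedMap (F : C ⥤ D) [F.Additive] : BoundedHomotopyCategory C ⥤ BoundedHomotopyCategory D :=
  (bounded D).lift ((bounded C).ι ⋙ F.mapHomotopyCategory (.up ℤ)) fun X => by
    obtain ⟨a, b, h⟩ := X.property
    exact ⟨a, b, fun n hn => F.map_isZero (h n hn)⟩

instance [F.Full] [F.Faithful] : (boundedMap F).Full := by unfold boundedMap; infer_instance

instance [F.Full] [F.Faithful] : (boundedMap F).Faithful := by unfold boundedMap; infer_instance

instance : (boundedMap F).Additive where
  map_add {X Y f g} := by
    ext : 1
    exact (F.mapHomotopyCategory (.up ℤ)).map_add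

lemma isTwoTerm_boundedMap {X : BoundedHomotopyCategory C} (hX : IsTwoTerm X) :
    IsTwoTerm ((boundedMap F).obj X) := fun n h₁ h₀ => F.map_isZero (hX n h₁ h₀)

lemma exists_boundedMap_iso [F.Full] [F.Faithful] {K : CochainComplex D ℤ} (hK : IsTwoTermComplex K)
    (h : ∀ n, F.essImage (K.X n)) {Z : BoundedHomotopyCategory D}
    (e : Z.obj ≅ (HomotopyCategory.quotient D (.up ℤ)).obj K) :
    ∃ Y : BoundedHomotopyCategory C, IsTwoTerm Y ∧ Nonempty ((boundedMap F).obj Y ≅ Z) := by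
  obtain ⟨L, ⟨e'⟩⟩ := exists_mapHomologicalComplex_iso F K h
  have hL : IsTwoTermComplex L := fun n h₁ h₀ => isZero_of_isZero_map F
    ((hK n h₁ h₀).of_iso ((HomologicalComplex.eval D (.up ℤ) n).mapIso e'))
  exact ⟨hL.toBounded, hL, ⟨(bounded D).isoMk
    ((HomotopyCategory.quotient D (.up ℤ)).mapIso e' ≪≫ e.symm)⟩⟩

lemma homShiftZero_boundedMap_iff [F.Full] [F.Faithful] (X Y : BoundedHomotopyCategory C) :
    HomShiftZero ((boundedMap F).obj X) ((boundedMap F).obj Y) ↔ HomShiftZero X Y := by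
  rw [← homShiftZero_map_iff (bounded D).ι, ← homShiftZero_map_iff (bounded C).ι]
  exact homShiftZero_map_iff (F.mapHomotopyCategory (.up ℤ)) X.obj Y.obj

lemma indecomposable_of_boundedMap [F.Full] [F.Faithful] [HasZeroObject C] [HasZeroObject D]
    [HasBinaryBiproducts C] [HasBinaryBiproducts D] {X : BoundedHomotopyCategory C}
    (h : Indecomposable ((boundedMap F).obj X)) : Indecomposable X := by
  have := preservesBinaryBiproducts_of_preservesBiproducts (boundedMap F)
  refine ⟨fun hX => h.1 ((boundedMap F).map_isZero hX), fun Y Z e => ?_⟩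
  refine (h.2 _ _ ((boundedMap F).mapIso e ≪≫ (boundedMap F).mapBiprod Y Z)).imp ?_ ?_
  · exact isZero_of_isZero_map _
  · exact isZero_of_isZero_map _

end Transport

/-! ### Faces in terms of pairs of vertices -/

section Faces

variable {A : Type u} [Ring A]

lemma mem_siltingComplex_faces_iff (s : Finset (SiltingVertex A)) :
    s ∈ (siltingComplex A).faces ↔
      s.Nonempty ∧ ∀ v ∈ s, ∀ w ∈ s, HomShiftZero v.rep w.rep := by
  refine and_congr_right fun _ => ?_
  rw [isRigid_biproduct_iff]
  simp

lemma SiltingVertex.nonempty_rep_iso (X : IndecomposableRigid A) :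
    Nonempty (SiltingVertex.rep (Quotient.mk _ X) ≅ X.1) :=
  Quotient.exact (Quotient.out_eq (Quotient.mk (indecomposableRigidSetoid A) X))

end Faces

/-! ### Comparison of silting complexes along a fully faithful functor -/

section Main

variable {A B : Type u} [Ring A] [Ring B] {k : Type*} {V : Type u} [Finite V] [Field k]
  (S : VertexSystem A k V) (J : Finset V) (F : Proj B ⥤ Proj A) [F.Additive]

open VertexSystem

variable {S J F}

/-- A decomposition of the image must be pulled back to `X`. Its summands have representatives whose
terms are retracts of terms in the image of `F`; these are still supported on `J`, so the summands
come from objects over `B`. -/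
lemma indecomposable_boundedMap [F.Full] [F.Faithful] (hF : ∀ P, F.essImage P ↔ ∀ i ∉ J, S.mult i P = 0) {X : KbProj B}
    (hX : IsTwoTerm X) (h : Indecomposable X) : Indecomposable ((boundedMap F).obj X) := by
  have key : ∀ Z : KbProj A, Retract Z ((boundedMap F).obj X) →
      ∃ Y : KbProj B, Nonempty ((boundedMap F).obj Y ≅ Z) := by
    intro Z p
    obtain ⟨L, hL, ⟨e⟩, hret⟩ := exists_isTwoTermComplex_of_retract S
      (K := ((boundedMap F).obj X).obj.as) (isTwoTerm_boundedMap F hX) (Z := Z.obj)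
      (p.map (bounded (Proj A)).ι)
    have hess : ∀ n, F.essImage (L.X n) := fun n => (hF _).2 fun i hi =>
      Nat.eq_zero_of_le_zero ((mult_le_of_retract (hret n).some).trans
        ((hF _).1 (F.obj_mem_essImage _) i hi).le)
    obtain ⟨Y, -, hY⟩ := exists_boundedMap_iso F hL hess e
    exact ⟨Y, hY⟩
  have := preservesBinaryBiproducts_of_preservesBiproducts (boundedMap F)
  refine ⟨fun hX' => h.1 (isZero_of_isZero_map _ hX'), fun Y Z e => ?_⟩
  obtain ⟨Y', ⟨eY⟩⟩ := key Y ⟨biprod.inl ≫ e.inv, e.hom ≫ biprod.fst, by simp⟩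
  obtain ⟨Z', ⟨eZ⟩⟩ := key Z ⟨biprod.inr ≫ e.inv, e.hom ≫ biprod.snd, by simp⟩
  have e' : X ≅ Y' ⊞ Z' := (boundedMap F).preimageIso
    (e ≪≫ biprod.mapIso eY.symm eZ.symm ≪≫ ((boundedMap F).mapBiprod Y' Z').symm)
  refine (h.2 _ _ e').imp (fun h' => ?_) (fun h' => ?_)
  · exact ((boundedMap F).map_isZero h').of_iso eY.symm
  · exact ((boundedMap F).map_isZero h').of_iso eZ.symm

lemma of_boundedMap_mem_coordinateSubspace (hF : ∀ P, F.essImage P ↔ ∀ i ∉ J, S.mult i P = 0)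
    {X : KbProj B} (hX : IsTwoTerm X) :
    K0.of ((boundedMap F).obj X) ∈ coordinateSubspace S.e S.isIdempotentElem_e J := by
  rw [K0.of_twoTerm _ (isTwoTerm_boundedMap F hX)]
  refine sub_mem ?_ ?_
  · exact S.of_inDegreeZero_mem_coordinateSubspace ((hF _).1 (F.obj_mem_essImage _))
  · exact S.of_inDegreeZero_mem_coordinateSubspace ((hF _).1 (F.obj_mem_essImage _))

/-- For `i ∉ J` the coordinate of the g-vector is zero, so the two terms of a minimal representative
have the same multiplicity at `i`. By rigidity one of the two multiplicities vanishes, hence both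
do, and the terms lie in the image of `F`. -/
lemma exists_boundedMap_iso_of_mem_coordinateSubspace [F.Full] [F.Faithful]
    (hF : ∀ P, F.essImage P ↔ ∀ i ∉ J, S.mult i P = 0) {X : KbProj A} (hX : IsTwoTerm X)
    (hrig : IsRigid X) (hJ : K0.of X ∈ coordinateSubspace S.e S.isIdempotentElem_e J) :
    ∃ Y : KbProj B, IsTwoTerm Y ∧ Nonempty ((boundedMap F).obj Y ≅ X) := by
  obtain ⟨K, hK, hmin, ⟨e⟩, -⟩ := exists_isMinimal (S := S) (K := X.obj.as) hX
  have hrig' : HomShiftZero X.obj X.obj := (homShiftZero_map_iff (bounded (Proj A)).ι X X).2 hrig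
  have hrigK := (homShiftZero_iff_of_iso e.symm e.symm).1 hrig'
  have hmult : ∀ i ∉ J, S.mult i (K.X (-1)) = 0 ∧ S.mult i (K.X 0) = 0 := by
    intro i hi
    have h₁ : S.eulerChar i K = 0 := by
      rw [← S.eulerChar_eq_of_iso i (K := X.obj.as) (L := K) X.property hK.toBounded.property e,
        ← coordinate_of, S.coordinate_eq_zero_of_mem hi hJ]
    rw [S.eulerChar_twoTerm i hK] at h₁
    have h₂ := hmin.mult_eq_zero hK hrigK i
    omega
  refine exists_boundedMap_iso F hK (fun n => (hF _).2 fun i hi => ?_) e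
  by_cases h₁ : n = -1
  · subst h₁; exact (hmult i hi).1
  by_cases h₀ : n = 0
  · subst h₀; exact (hmult i hi).2
  · exact S.mult_of_isZero i (hK n h₁ h₀)

/-- A fully faithful functor between categories of projective modules whose essential image
consists of the modules supported on `J` induces an isomorphism from the 2-term silting complex onto
the subcomplex of the objects with g-vector in the coordinate subspace of `J`. -/
theorem areIsomorphic_of_essImage_eq [F.Full] [F.Faithful] (hF : ∀ P, F.essImage P ↔ ∀ i ∉ J, S.mult i P = 0) :
    AreIsomorphic (siltingComplex B)
      (inducedSubcomplex (siltingComplex A)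
        {v | v.gVector ∈ coordinateSubspace S.e S.isIdempotentElem_e J}) := by
  let G := boundedMap F
  let obj : IndecomposableRigid B → IndecomposableRigid A := fun X =>
    ⟨G.obj X.1, isTwoTerm_boundedMap F X.2.1, (homShiftZero_boundedMap_iff F X.1 X.1).2 X.2.2.1,
      indecomposable_boundedMap hF X.2.1 X.2.2.2⟩
  let φ : SiltingVertex B → SiltingVertex A :=
    Quotient.map (sa := indecomposableRigidSetoid B) (sb := indecomposableRigidSetoid A) obj
      fun X Y ⟨e⟩ => ⟨G.mapIso e⟩
  -- Faces are tested on chosen representatives, and the functor matches these only up to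
  -- isomorphism.
  have hφ : ∀ v, Nonempty ((φ v).rep ≅ G.obj v.rep) := by
    intro v
    have h := SiltingVertex.nonempty_rep_iso (obj (Quotient.out v))
    have h₂ : Quotient.mk (indecomposableRigidSetoid A) (obj (Quotient.out v)) = φ v :=
      congrArg φ (Quotient.out_eq v)
    rw [h₂] at h
    exact h
  have hmem : ∀ v, φ v ∈
      {v | SiltingVertex.gVector v ∈ coordinateSubspace S.e S.isIdempotentElem_e J} := by
    intro v
    obtain ⟨X, rfl⟩ := Quotient.exists_rep v
    exact of_boundedMap_mem_coordinateSubspace hF X.2.1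
  let ψ : SiltingVertex B → {v : SiltingVertex A | v.gVector ∈
    coordinateSubspace S.e S.isIdempotentElem_e J} := fun v => ⟨φ v, hmem v⟩
  have hψ : Function.Bijective ψ := by
    constructor
    · intro v w h
      obtain ⟨X, rfl⟩ := Quotient.exists_rep v
      obtain ⟨Y, rfl⟩ := Quotient.exists_rep w
      obtain ⟨e⟩ : Nonempty (G.obj X.1 ≅ G.obj Y.1) := Quotient.exact (congrArg Subtype.val h)
      exact Quotient.sound ⟨G.preimageIso e⟩
    · rintro ⟨v, hv⟩
      obtain ⟨X, rfl⟩ := Quotient.exists_rep v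
      obtain ⟨Y, hY, ⟨e⟩⟩ := exists_boundedMap_iso_of_mem_coordinateSubspace hF X.2.1 X.2.2.1 hv
      refine ⟨Quotient.mk _ ⟨Y, hY, ?_, ?_⟩, Subtype.ext (Quotient.sound ⟨e⟩)⟩
      · exact (homShiftZero_boundedMap_iff F Y Y).1
          ((homShiftZero_iff_of_iso e e).1 X.2.2.1)
      · refine indecomposable_of_boundedMap F ⟨fun h => X.2.2.2.1 (h.of_iso e.symm), fun P Q i => ?_⟩
        exact X.2.2.2.2 _ _ (e.symm ≪≫ i)
  refine ⟨Equiv.ofBijective ψ hψ, fun s => ?_⟩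
  change _ ↔ (s.map _).map _ ∈ (siltingComplex A).faces
  rw [mem_siltingComplex_faces_iff, mem_siltingComplex_faces_iff]
  simp only [Finset.map_nonempty, Finset.mem_map, forall_exists_index, and_imp,
    forall_apply_eq_imp_iff₂]
  refine and_congr_right fun _ => forall₂_congr fun v _ => forall₂_congr fun w _ => ?_
  obtain ⟨e⟩ := hφ v
  obtain ⟨e'⟩ := hφ w
  rw [← homShiftZero_boundedMap_iff F]
  exact homShiftZero_iff_of_iso e e'

end Main

/-! ### The projective module of an idempotent -/

section IdempotentProj

variable {A : Type u} [Ring A]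

lemma mem_span_idempotent_iff {e : A} (he : IsIdempotentElem e) {x : A} :
    x ∈ Submodule.span Aᵐᵒᵖ {e} ↔ e * x = x := by
  rw [Submodule.mem_span_singleton]
  constructor
  · rintro ⟨a, rfl⟩
    rw [mul_smul_comm, he.eq]
  · intro h
    exact ⟨MulOpposite.op x, h⟩

/-- Left multiplication, as a morphism between projective modules. -/
def mulLeft {e e' : A} (he : IsIdempotentElem e) (he' : IsIdempotentElem e') (a : A)
    (ha : e' * a = a) : idempotentProj e he ⟶ idempotentProj e' he' :=
  Proj.ofLin (P := idempotentProj e he) (Q := idempotentProj e' he')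
    { toFun := fun y : Submodule.span Aᵐᵒᵖ {e} =>
        (⟨a * y.1, (mem_span_idempotent_iff he').2 (by rw [← mul_assoc, ha])⟩ :
          Submodule.span Aᵐᵒᵖ {e'})
      map_add' := fun x y => Subtype.ext (mul_add a x.1 y.1)
      map_smul' := fun b x => Subtype.ext (mul_smul_comm b a x.1) }

lemma idempotentProj_hom_ext {e e' : A} {he : IsIdempotentElem e} {he' : IsIdempotentElem e'}
    {f g : idempotentProj e he ⟶ idempotentProj e' he'}
    (h : ∀ y : Submodule.span Aᵐᵒᵖ {e}, (show Submodule.span Aᵐᵒᵖ {e'} from Proj.lin f y).1 =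
      (show Submodule.span Aᵐᵒᵖ {e'} from Proj.lin g y).1) : f = g :=
  Proj.lin_injective (LinearMap.ext fun y => Subtype.ext (h y))

lemma mulLeft_comp {e e' e'' : A} (he : IsIdempotentElem e) (he' : IsIdempotentElem e')
    (he'' : IsIdempotentElem e'') (a b : A) (ha : e' * a = a) (hb : e'' * b = b) :
    mulLeft he he' a ha ≫ mulLeft he' he'' b hb =
      mulLeft he he'' (b * a) (by rw [← mul_assoc, hb]) :=
  idempotentProj_hom_ext fun y => (mul_assoc b a y.1).symm

lemma mulLeft_self {e : A} (he : IsIdempotentElem e) : mulLeft he he e he.eq = 𝟙 _ :=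
  idempotentProj_hom_ext fun y => (mem_span_idempotent_iff he).1 y.2

/-- The endomorphism ring of the projective module of an idempotent. -/
lemma exists_equiv_end {B : Type*} [Ring B] {e : A} (he : IsIdempotentElem e) (θ : B →ₙ+* A)
    (hθ : Function.Injective θ) (hrange : ∀ a, (∃ b, θ b = a) ↔ e * a = a ∧ a * e = a) :
    Nonempty (B ≃+* End (idempotentProj e he)) := by
  have h₁ : ∀ b, e * θ b = θ b := fun b => ((hrange _).1 ⟨b, rfl⟩).1
  have h₂ : ∀ b, θ b * e = θ b := fun b => ((hrange _).1 ⟨b, rfl⟩).2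
  -- The map `θ` is not assumed unital; `θ 1` is the unit of its range, which contains `e` as unit.
  have hone : θ 1 = e := by
    obtain ⟨b, hb⟩ := (hrange e).2 ⟨he, he⟩
    rw [← h₂ 1, ← hb, ← map_mul, one_mul]
  let σ : B →+* End (idempotentProj e he) :=
    { toFun := fun b => End.of (mulLeft he he (θ b) (h₁ b))
      map_one' := by
        refine (?_ : mulLeft he he (θ 1) (h₁ 1) = 𝟙 _)
        simp only [hone]
        exact mulLeft_self he
      -- Multiplication in `End` is composition of functions, so left multiplications give `B`
      -- itself and not its opposite.
      map_mul' := fun b c => by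
        refine (?_ : mulLeft he he (θ (b * c)) _ = mulLeft he he (θ c) _ ≫ mulLeft he he (θ b) _)
        rw [mulLeft_comp]
        simp only [map_mul]
      map_zero' := idempotentProj_hom_ext fun y =>
        (congrArg (· * y.1) (map_zero θ)).trans (zero_mul y.1)
      map_add' := fun b c => idempotentProj_hom_ext fun y =>
        (congrArg (· * y.1) (map_add θ b c)).trans (add_mul _ _ y.1) }
  let g : Submodule.span Aᵐᵒᵖ {e} := ⟨e, Submodule.mem_span_singleton_self e⟩
  refine ⟨RingEquiv.ofBijective σ ⟨fun b c h => hθ ?_, fun f => ?_⟩⟩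
  · have h₃ : (show Submodule.span Aᵐᵒᵖ {e} from Proj.lin (End.asHom (σ b)) g).1 =
        (show Submodule.span Aᵐᵒᵖ {e} from Proj.lin (End.asHom (σ c)) g).1 := by rw [h]
    rw [← h₂ b, ← h₂ c]
    exact h₃
  · let f' : Submodule.span Aᵐᵒᵖ {e} →ₗ[Aᵐᵒᵖ] Submodule.span Aᵐᵒᵖ {e} := Proj.lin (End.asHom f)
    -- An endomorphism is left multiplication by the image of the generator `e`, and this image lies
    -- in `eAe`, the range of `θ`.
    have hf : ∀ y : Submodule.span Aᵐᵒᵖ {e}, (f' g).1 * y.1 = (f' y).1 := by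
      intro y
      have h₃ : y = MulOpposite.op y.1 • g :=
        Subtype.ext ((mem_span_idempotent_iff he).1 y.2).symm
      conv_rhs => rw [h₃, map_smul]
      rfl
    obtain ⟨b, hb⟩ := (hrange (f' g).1).2 ⟨(mem_span_idempotent_iff he).1 (f' g).2, hf g⟩
    refine ⟨b, idempotentProj_hom_ext fun y => ?_⟩
    exact (congrArg (· * y.1) hb).trans (hf y)

end IdempotentProj

/-! ### Summands of sums of `eA` and the support of the top -/

section Support

variable {A : Type u} [Ring A] {k V : Type*} [Field k] (S : VertexSystem A k V)

open VertexSystem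

lemma mult_idempotentProj_eq_zero {e : A} (he : IsIdempotentElem e) {i : V} (h : S.aug i e = 0) :
    S.mult i (idempotentProj e he) = 0 := by
  refine mult_eq_zero_iff.2 fun l => ?_
  let l' : Submodule.span Aᵐᵒᵖ {e} →ₗ[Aᵐᵒᵖ] CharModule (S.augOp i) := l
  let g : Submodule.span Aᵐᵒᵖ {e} := ⟨e, Submodule.mem_span_singleton_self e⟩
  have hg : l' g = 0 := by
    have h₁ : g = MulOpposite.op e • g := Subtype.ext he.symm
    rw [h₁, map_smul, CharModule.smul_def, augOp_op, h, zero_smul]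
  refine LinearMap.ext fun (y : Submodule.span Aᵐᵒᵖ {e}) => ?_
  have h₂ : y = MulOpposite.op y.1 • g := Subtype.ext ((mem_span_idempotent_iff he).1 y.2).symm
  change l' y = 0
  rw [h₂, map_smul, hg, smul_zero]

/-- The direct summands of the finite direct sums of `e A`, where `e` is the sum of the idempotents
of the vertices in `J`, are the projective modules whose top is supported on `J`. -/
lemma addClosure_idempotentProj_iff [Finite V] {J : Finset V}
    (horth : ∀ i j, i ≠ j → S.e i * S.e j = 0)
    (he : IsIdempotentElem (∑ j ∈ J, S.e j)) (P : Proj A) :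
    addClosure (idempotentProj (∑ j ∈ J, S.e j) he) P ↔ ∀ i ∉ J, S.mult i P = 0 := by
  constructor
  · rintro ⟨n, a, r, h⟩ i hi
    have h₁ : S.mult i (idempotentProj (∑ j ∈ J, S.e j) he) = 0 := by
      refine mult_idempotentProj_eq_zero S he ?_
      rw [map_sum]
      exact Finset.sum_eq_zero fun j hj => S.aug_ne i j (ne_of_mem_of_not_mem hj hi)
    rw [mult_eq_zero_iff] at h₁ ⊢
    intro l
    have h₂ : precomp i (𝟙 P) l = 0 := by
      rw [← h]
      refine Finset.sum_induction _ (fun f : P ⟶ P => precomp i f l = 0) ?_ ?_ ?_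
      · intro f g hf hg
        rw [precomp_add, LinearMap.add_apply, hf, hg, add_zero]
      · rw [precomp_zero, LinearMap.zero_apply]
      · intro t _
        rw [← precomp_precomp, h₁ (precomp i (r t) l), map_zero]
    exact h₂
  · intro hP
    refine proj_induction (S := S) (J := J) (motive := addClosure (idempotentProj _ he))
      (fun P h => addClosure_of_isZero h) (fun P Q i hi w hQ => ?_) P (fun i hi => hP i hi)
    obtain ⟨n, a, r, h⟩ := hQ
    have hei : (∑ j ∈ J, S.e j) * S.e i = S.e i := by
      rw [Finset.sum_mul, Finset.sum_eq_single i]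
      · exact S.isIdempotentElem_e i
      · intro j _ hj
        exact horth j i hj
      · intro h
        exact absurd hi h
    -- As `i ∈ J`, left multiplication by `e i` gives both the inclusion of the projective of `i`
    -- and the projection onto it.
    let p : Retract (S.proj i) (idempotentProj _ he) :=
      { i := mulLeft _ he (S.e i) hei
        r := mulLeft he _ (S.e i) (S.isIdempotentElem_e i).eq
        retract := by
          rw [mulLeft_comp]
          simp only [(S.isIdempotentElem_e i).eq]
          exact mulLeft_self _ }
    refine ⟨n + 1, Fin.cons (w.hom ≫ biprod.fst ≫ p.i) fun t => w.hom ≫ biprod.snd ≫ a t,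
      Fin.cons (p.r ≫ biprod.inl ≫ w.inv) fun t => r t ≫ biprod.inr ≫ w.inv, ?_⟩
    rw [Fin.sum_univ_succ]
    simp only [Fin.cons_zero, Fin.cons_succ, Category.assoc]
    rw [p.retract_assoc, ← Preadditive.comp_sum, ← Preadditive.comp_sum]
    simp only [← Category.assoc (a _)]
    rw [← Preadditive.sum_comp, h, Category.id_comp, ← Preadditive.comp_add]
    have h₃ : biprod.fst ≫ biprod.inl ≫ w.inv + biprod.snd ≫ biprod.inr ≫ w.inv = w.inv := by
      rw [← Category.assoc, ← Category.assoc, ← Preadditive.add_comp, biprod.total,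
        Category.id_comp]
    rw [h₃, w.hom_inv_id]

end Support

/-! ### Paths of the shortcut quiver -/

section Paths

variable {V : Type u} [Quiver.{u} V] {R : QuadraticRelations V} {J : Finset V}

open Quiver

lemma AvoidsRelations.of_comp_left {i j l : V} {p : Path i j} {q : Path j l}
    (h : AvoidsRelations R (p.comp q)) : AvoidsRelations R p := by
  intro x y z p₁ a b p₂ hp
  exact h p₁ a b (p₂.comp q) (by rw [hp, Path.comp_assoc])

lemma AvoidsRelations.of_comp_right {i j l : V} {p : Path i j} {q : Path j l}
    (h : AvoidsRelations R (p.comp q)) : AvoidsRelations R q := by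
  intro x y z p₁ a b p₂ hq
  refine h (p.comp p₁) a b p₂ ?_
  rw [hq, ← Path.comp_cons, ← Path.comp_cons, Path.comp_assoc]

lemma avoidsRelations_nil (i : V) : AvoidsRelations R (Path.nil : Path i i) := by
  intro x y z p₁ a b p₂ hp
  have := congrArg Path.length hp
  simp [Path.length_comp] at this
  omega

lemma avoidsRelations_cons_iff {i j l : V} {p : Path i j} {c : j ⟶ l} :
    AvoidsRelations R (p.cons c) ↔
      AvoidsRelations R p ∧ ∀ ⦃x : V⦄ (p' : Path i x) (b : x ⟶ j), p = p'.cons b → ¬ R b c := by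
  constructor
  · intro h
    refine ⟨AvoidsRelations.of_comp_left (q := c.toPath) h, fun x p' b hp => ?_⟩
    exact h p' b c Path.nil (by rw [hp, Path.comp_nil])
  · rintro ⟨h₁, h₂⟩ x y z p₁ a b p₂ hp
    cases p₂ with
    | nil =>
      rw [Path.comp_nil] at hp
      cases hp
      exact h₂ p₁ a rfl
    | cons p₂ d =>
      rw [Path.comp_cons] at hp
      cases hp
      exact h₁ p₁ a b p₂ rfl

/-- Relations have length two, so none can meet both `p` and `r` when `q` has positive length. -/
lemma AvoidsRelations.comp {i j l m : V} {p : Path i j} {q : Path j l} {r : Path l m}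
    (hpq : AvoidsRelations R (p.comp q)) (hqr : AvoidsRelations R (q.comp r))
    (hq : 0 < q.length) : AvoidsRelations R ((p.comp q).comp r) := by
  induction r with
  | nil => exact hpq
  | cons r c ih =>
    rw [Path.comp_cons, avoidsRelations_cons_iff] at hqr ⊢
    refine ⟨ih hqr.1, fun x p' b hp => ?_⟩
    rw [Path.comp_assoc] at hp
    have hlen : 0 < (q.comp r).length := by rw [Path.length_comp]; omega
    revert hp hqr hlen
    generalize q.comp r = s
    intro hqr hp hlen
    cases s with
    | nil => simp at hlen
    | cons s d =>
      rw [Path.comp_cons] at hp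
      cases hp
      exact hqr.2 _ _ rfl

lemma exists_comp_eq_of_comp_eq_comp {i j j' l : V} {p : Path i j} {q : Path j l} {p' : Path i j'}
    {q' : Path j' l} (h : p.comp q = p'.comp q') (hlen : q.length ≤ q'.length) :
    ∃ c : Path j' j, q' = c.comp q ∧ p = p'.comp c := by
  induction q with
  | nil => exact ⟨q', rfl, h⟩
  | @cons m l q b ih =>
    cases q' with
    | nil => simp at hlen
    | @cons m' _ q' b' =>
      rw [Path.comp_cons, Path.comp_cons] at h
      obtain rfl : m = m' := Path.obj_eq_of_cons_eq_cons h
      obtain ⟨c, hc, hc'⟩ := ih (eq_of_heq (Path.heq_of_cons_eq_cons h))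
        (by simpa only [Path.length_cons, add_le_add_iff_right] using hlen)
      refine ⟨c, ?_, hc'⟩
      rw [Path.comp_cons, hc, eq_of_heq (Path.hom_heq_of_cons_eq_cons h)]

/-- The path of the given quiver which corresponds to a path of the shortcut quiver. -/
def flatten {i : Shortcut R J} : ∀ {j : Shortcut R J}, Path i j → Path i.1 j.1
  | _, Path.nil => Path.nil
  | _, Path.cons p a => (flatten p).comp a.1

lemma flatten_nil (i : Shortcut R J) : flatten (Path.nil : Path i i) = Path.nil := rfl

lemma flatten_cons {i j l : Shortcut R J} (p : Path i j) (a : j ⟶ l) :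
    flatten (p.cons a) = (flatten p).comp a.1 := rfl

lemma flatten_comp {i j l : Shortcut R J} (p : Path i j) (q : Path j l) :
    flatten (p.comp q) = (flatten p).comp (flatten q) := by
  induction q with
  | nil => rfl
  | cons q a ih => rw [Path.comp_cons, flatten_cons, ih, flatten_cons, Path.comp_assoc]

/-- The last arrow is recovered from the flattened path. Of two candidates the shorter is a tail of
the longer; if it were a proper tail, its starting point would be an interior vertex of the longer
one lying in `J`. -/
lemma flatten_injective {i j : Shortcut R J} :
    Function.Injective (flatten : Path i j → Path i.1 j.1) := by
  intro p
  induction p with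
  | nil =>
    intro q h
    cases q with
    | nil => rfl
    | cons q a =>
      have h₁ := congrArg Path.length h
      rw [flatten_cons, Path.length_comp, flatten_nil, Path.length_nil] at h₁
      have h₂ := a.2.1
      omega
  | @cons m j p a ih =>
    intro q h
    cases q with
    | nil =>
      have h₁ := congrArg Path.length h
      rw [flatten_cons, Path.length_comp, flatten_nil, Path.length_nil] at h₁
      have h₂ := a.2.1
      omega
    | @cons m' _ q b =>
      rw [flatten_cons, flatten_cons] at h
      have key : ∀ {m m' : Shortcut R J} (p : Path i m) (q : Path i m') (a : m ⟶ j) (b : m' ⟶ j),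
          (flatten p).comp a.1 = (flatten q).comp b.1 → a.1.length ≤ b.1.length →
          ∃ e : m = m', HEq a b ∧ flatten (e ▸ p) = flatten q := by
        intro m m' p q a b h hlen
        obtain ⟨c, hc₁, hc₂⟩ := exists_comp_eq_of_comp_eq_comp h hlen
        have hc : c.length = 0 := by
          by_contra hc
          exact b.2.2.2 c a.1 hc₁ (Nat.pos_of_ne_zero hc) a.2.1 m.2
        obtain rfl : m = m' := Subtype.ext (Path.eq_of_length_zero c hc).symm
        obtain rfl := Path.eq_nil_of_length_zero c hc
        rw [Path.nil_comp] at hc₁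
        refine ⟨rfl, heq_of_eq (Subtype.ext hc₁.symm), hc₂⟩
      rcases le_total a.1.length b.1.length with hlen | hlen
      · obtain ⟨rfl, hab, hpq⟩ := key p q a b h hlen
        rw [eq_of_heq hab, ih hpq]
      · obtain ⟨rfl, hab, hpq⟩ := key q p b a h.symm hlen
        rw [eq_of_heq hab, ih hpq.symm]

/-- A path with an interior vertex in `J` is cut there into two shorter paths; a path of positive
length without one is itself an arrow. -/
lemma exists_flatten_eq {i j : Shortcut R J} (p : Path i.1 j.1) (hp : AvoidsRelations R p) :
    ∃ q : Path i j, flatten q = p := by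
  induction hn : p.length using Nat.strong_induction_on generalizing i j with
  | h n ih =>
    subst hn
    by_cases h₀ : p.length = 0
    · obtain rfl : i = j := Subtype.ext (Path.eq_of_length_zero p h₀)
      exact ⟨Path.nil, (Path.eq_nil_of_length_zero p h₀).symm⟩
    by_cases h₁ : NoInteriorVertexIn J p
    · let a : i ⟶ j := ⟨p, Nat.pos_of_ne_zero h₀, hp, h₁⟩
      exact ⟨a.toPath, Path.nil_comp p⟩
    · unfold NoInteriorVertexIn at h₁
      push Not at h₁
      obtain ⟨x, p₁, p₂, rfl, hp₁, hp₂, hx⟩ := h₁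
      rw [Path.length_comp] at ih
      let m : Shortcut R J := ⟨x, hx⟩
      obtain ⟨q₁, hq₁⟩ := ih p₁.length (by omega) (i := i) (j := m) p₁ hp.of_comp_left rfl
      obtain ⟨q₂, hq₂⟩ := ih p₂.length (by omega) (i := m) (j := j) p₂ hp.of_comp_right rfl
      exact ⟨q₁.comp q₂, by rw [flatten_comp, hq₁, hq₂]⟩

/-- A relation in the flattened path lies inside one arrow, which is excluded, or astride two
consecutive arrows. It cannot reach further, because arrows have positive length. -/
lemma avoidsRelations_flatten_iff {i j : Shortcut R J} (p : Path i j) :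
    AvoidsRelations R (flatten p) ↔ AvoidsRelations (shortcutRelations R J) p := by
  constructor
  · intro h x y z p₁ a b p₂ hp hab
    rw [hp, flatten_comp, flatten_cons, flatten_cons] at h
    have h := h.of_comp_left
    rw [Path.comp_assoc] at h
    exact hab h.of_comp_right
  · intro h
    induction p with
    | nil => exact avoidsRelations_nil _
    | cons p b ih =>
      rw [avoidsRelations_cons_iff] at h
      have ih := ih h.1
      cases p with
      | nil =>
        rw [flatten_cons, flatten_nil, Path.nil_comp]
        exact b.2.2.1
      | cons p a =>
        rw [flatten_cons] at ih ⊢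
        exact ih.comp (not_not.1 (h.2 p a rfl)) a.2.1

end Paths

/-! ### Bound path algebras -/

section Concat

variable (k : Type u) [Field k] {V : Type u} [Quiver.{u} V]

open Quiver

/-- A coefficient of a product involves only the factorizations of the path. Ideals and the
filtration by length are thereby checked one path at a time. -/
lemma concat_apply_eq_zero {i l j : V} {f : Path i l →₀ k} {g : Path l j →₀ k} {p : Path i j}
    (h : ∀ q r, q.comp r = p → f q = 0 ∨ g r = 0) : concat k i l j f g p = 0 := by
  have hg : concat k i l j f g =
      f.sum fun q a => g.sum fun r b => Finsupp.single (q.comp r) (a * b) := by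
    rw [concat, Finsupp.linearCombination_apply, Finsupp.sum, LinearMap.sum_apply, Finsupp.sum]
    refine Finset.sum_congr rfl fun q _ => ?_
    rw [LinearMap.smul_apply, Finsupp.lmapDomain_apply, Finsupp.mapDomain, Finsupp.smul_sum]
    simp only [Finsupp.smul_single, smul_eq_mul]
  rw [hg, Finsupp.sum, Finsupp.finsetSum_apply]
  refine Finset.sum_eq_zero fun q _ => ?_
  rw [Finsupp.sum, Finsupp.finsetSum_apply]
  refine Finset.sum_eq_zero fun r _ => ?_
  by_cases hp : q.comp r = p
  · rcases h q r hp with h | h <;> simp [h]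
  · exact Finsupp.single_eq_of_ne (Ne.symm hp)

lemma concat_apply_nil {i : V} (f g : Path i i →₀ k) :
    concat k i i i f g Path.nil = f Path.nil * g Path.nil := by
  induction f using Finsupp.induction_linear with
  | zero => simp
  | add f f' hf hf' => simp only [map_add, LinearMap.add_apply, Finsupp.add_apply, hf, hf', add_mul]
  | single q a =>
    induction g using Finsupp.induction_linear with
    | zero => simp
    | add g g' hg hg' => simp only [map_add, Finsupp.add_apply, hg, hg', mul_add]
    | single r b =>
      rw [concat_single]
      by_cases hq : q = Path.nil
      · subst hq
        by_cases hr : r = Path.nil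
        · subst hr
          simp
        · rw [Path.nil_comp, Finsupp.single_eq_of_ne (Ne.symm hr),
            Finsupp.single_eq_of_ne (Ne.symm hr), mul_zero]
      · rw [Finsupp.single_eq_of_ne (Ne.symm hq), zero_mul, Finsupp.single_eq_of_ne]
        intro h
        have := congrArg Path.length h
        rw [Path.length_nil, Path.length_comp] at this
        exact hq (Path.eq_nil_of_length_zero q (by omega))

lemma concat_mapDomain_flatten {R : QuadraticRelations V} {J : Finset V} {i l j : Shortcut R J}
    (f : Path i l →₀ k) (g : Path l j →₀ k) :
    concat k i.1 l.1 j.1 (f.mapDomain flatten) (g.mapDomain flatten) =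
      (concat k i l j f g).mapDomain flatten := by
  induction f using Finsupp.induction_linear with
  | zero => simp
  | add f f' hf hf' => simp only [map_add, LinearMap.add_apply, Finsupp.mapDomain_add, hf, hf']
  | single q a =>
    induction g using Finsupp.induction_linear with
    | zero => simp
    | add g g' hg hg' => simp only [map_add, Finsupp.mapDomain_add, hg, hg']
    | single r b => simp only [Finsupp.mapDomain_single, concat_single, flatten_comp]

end Concat

/-! ### Path algebras and their quotients by monomial relations -/

section PathAlgebra

variable {k : Type u} [Field k] {V : Type u} [Quiver.{u} V] [DecidableEq V]

open Quiver

namespace PathAlgebra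

variable (k) in
/-- The elements of the path algebra which are linear combinations of paths from `i` to `j`. -/
def block (i j : V) (x : Path i j →₀ k) : PathAlgebra k V :=
  Pi.single (M := fun i => ∀ j : V, Path i j →₀ k) i
    (Pi.single (M := fun j => Path i j →₀ k) j x)

lemma block_same (i j : V) (x : Path i j →₀ k) : block k i j x i j = x := by
  simp [block]

lemma block_of_ne_left {i j : V} (x : Path i j →₀ k) {i' : V} (j' : V) (h : i' ≠ i) :
    block k i j x i' j' = 0 := by
  simp [block, Pi.single_eq_of_ne h]

lemma block_of_ne_right {i j : V} (x : Path i j →₀ k) (i' : V) {j' : V} (h : j' ≠ j) :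
    block k i j x i' j' = 0 := by
  by_cases hi : i' = i
  · subst hi
    simp [block, Pi.single_eq_of_ne h]
  · exact block_of_ne_left x j' hi

variable [Fintype V]

protected lemma add_apply (f g : PathAlgebra k V) (i j : V) : (f + g) i j = f i j + g i j := rfl

protected lemma zero_apply (i j : V) : (0 : PathAlgebra k V) i j = 0 := rfl

protected lemma mul_apply (f g : PathAlgebra k V) (i j : V) :
    (f * g) i j = ∑ l : V, concat k i l j (f i l) (g l j) := rfl

lemma one_apply_same (i : V) : (1 : PathAlgebra k V) i i = Finsupp.single Path.nil 1 :=
  Pi.single_eq_same (M := fun j => Path i j →₀ k) i _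

protected lemma sum_apply {ι : Type*} (s : Finset ι) (f : ι → PathAlgebra k V) (i j : V) :
    (∑ x ∈ s, f x) i j = ∑ x ∈ s, f x i j :=
  map_sum (⟨⟨fun f : PathAlgebra k V => f i j, rfl⟩, fun _ _ => rfl⟩ :
    PathAlgebra k V →+ (Path i j →₀ k)) f s

lemma block_add (i j : V) (x y : Path i j →₀ k) :
    block k i j (x + y) = block k i j x + block k i j y := by
  funext i' j'
  rw [PathAlgebra.add_apply]
  by_cases hi : i' = i
  · subst hi
    by_cases hj : j' = j
    · subst hj
      simp only [block_same]
    · simp only [block_of_ne_right _ _ hj, add_zero]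
  · simp only [block_of_ne_left _ _ hi, add_zero]

lemma block_zero (i j : V) : block k i j 0 = 0 := by
  simpa using block_add i j (0 : Path i j →₀ k) 0

lemma sum_block (f : PathAlgebra k V) : ∑ i, ∑ j, block k i j (f i j) = f := by
  funext x y
  rw [PathAlgebra.sum_apply, Finset.sum_eq_single x, PathAlgebra.sum_apply, Finset.sum_eq_single y, block_same]
  · exact fun j _ hj => block_of_ne_right _ _ hj.symm
  · simp
  · intro i _ hi
    rw [PathAlgebra.sum_apply]
    exact Finset.sum_eq_zero fun j _ => block_of_ne_left _ _ hi.symm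
  · simp

lemma block_mul_block {i l j : V} (x : Path i l →₀ k) (y : Path l j →₀ k) :
    block k i l x * block k l j y = block k i j (concat k i l j x y) := by
  funext i' j'
  rw [PathAlgebra.mul_apply]
  by_cases hi : i' = i
  · subst hi
    by_cases hj : j' = j
    · subst hj
      rw [Finset.sum_eq_single l, block_same, block_same, block_same]
      · intro m _ hm
        rw [block_of_ne_right x _ hm, map_zero, LinearMap.zero_apply]
      · simp
    · rw [block_of_ne_right _ _ hj]
      exact Finset.sum_eq_zero fun m _ => by rw [block_of_ne_right y _ hj, map_zero]
  · rw [block_of_ne_left _ _ hi]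
    exact Finset.sum_eq_zero fun m _ => by
      rw [block_of_ne_left x _ hi, map_zero, LinearMap.zero_apply]

lemma ofPath_nil_mul_apply (i : V) (f : PathAlgebra k V) (x y : V) :
    (ofPath k (Path.nil : Path i i) * f) x y = if x = i then f x y else 0 := by
  change (block k i i (Finsupp.single Path.nil 1) * f) x y = _
  rw [PathAlgebra.mul_apply]
  split_ifs with h
  · subst h
    rw [Finset.sum_eq_single x, block_same, concat_nil_left]
    · intro m _ hm
      rw [block_of_ne_right _ _ hm, map_zero, LinearMap.zero_apply]
    · simp
  · exact Finset.sum_eq_zero fun m _ => by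
      rw [block_of_ne_left _ _ h, map_zero, LinearMap.zero_apply]

lemma mul_ofPath_nil_apply (i : V) (f : PathAlgebra k V) (x y : V) :
    (f * ofPath k (Path.nil : Path i i)) x y = if y = i then f x y else 0 := by
  change (f * block k i i (Finsupp.single Path.nil 1)) x y = _
  rw [PathAlgebra.mul_apply]
  split_ifs with h
  · subst h
    rw [Finset.sum_eq_single y, block_same, concat_nil_right]
    · intro m _ hm
      rw [block_of_ne_left _ _ hm, map_zero]
    · simp
  · exact Finset.sum_eq_zero fun m _ => by rw [block_of_ne_right _ _ h, map_zero]

/-- The coefficient of the path of length zero at the vertex `i`. -/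
def nilCoeff (i : V) : PathAlgebra k V →+* k where
  toFun f := f i i Path.nil
  map_zero' := rfl
  map_one' := by rw [one_apply_same, Finsupp.single_eq_same]
  map_add' _ _ := rfl
  map_mul' f g := by
    rw [PathAlgebra.mul_apply, Finsupp.finsetSum_apply, Finset.sum_eq_single i, concat_apply_nil]
    · intro l _ hl
      refine concat_apply_eq_zero k fun q r h => (hl ?_).elim
      have := congrArg Path.length h
      rw [Path.length_nil, Path.length_comp] at this
      exact (Path.eq_of_length_zero q (by omega)).symm
    · simp

/-- The elements of the path algebra which are linear combinations of paths of length at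
least `n`. -/
def IsDeep (n : ℕ) (f : PathAlgebra k V) : Prop :=
  ∀ ⦃i j : V⦄ (p : Path i j), p.length < n → f i j p = 0

lemma IsDeep.mul {n m : ℕ} {f g : PathAlgebra k V} (hf : IsDeep n f) (hg : IsDeep m g) :
    IsDeep (n + m) (f * g) := by
  intro i j p hp
  rw [PathAlgebra.mul_apply, Finsupp.finsetSum_apply]
  refine Finset.sum_eq_zero fun l _ => concat_apply_eq_zero k fun q r h => ?_
  rw [← h, Path.length_comp] at hp
  rcases lt_or_ge q.length n with hq | hq
  · exact Or.inl (hf q hq)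
  · exact Or.inr (hg r (by omega))

end PathAlgebra

open PathAlgebra

variable [Fintype V]

variable (k) in
/-- The elements of the path algebra all of whose paths contain a relation. -/
def spanOfRelations (R : QuadraticRelations V) : TwoSidedIdeal (PathAlgebra k V) :=
  TwoSidedIdeal.mk' {f | ∀ ⦃i j : V⦄ (p : Path i j), AvoidsRelations R p → f i j p = 0}
    (fun _ _ _ _ => rfl)
    (fun {f g} hf hg i j p hp => by
      rw [PathAlgebra.add_apply, Finsupp.add_apply, hf p hp, hg p hp, add_zero])
    (fun {f} hf i j p hp => (congrArg Neg.neg (hf p hp)).trans neg_zero)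
    (fun {f g} hg i j p hp => by
      rw [PathAlgebra.mul_apply, Finsupp.finsetSum_apply]
      refine Finset.sum_eq_zero fun l _ => concat_apply_eq_zero k fun q r h => Or.inr (hg r ?_)
      exact AvoidsRelations.of_comp_right (h ▸ hp))
    (fun {f g} hf i j p hp => by
      rw [PathAlgebra.mul_apply, Finsupp.finsetSum_apply]
      refine Finset.sum_eq_zero fun l _ => concat_apply_eq_zero k fun q r h => Or.inl (hf q ?_)
      exact AvoidsRelations.of_comp_left (h ▸ hp))

lemma mem_spanOfRelations {R : QuadraticRelations V} {f : PathAlgebra k V} :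
    f ∈ spanOfRelations k R ↔
      ∀ ⦃i j : V⦄ (p : Path i j), AvoidsRelations R p → f i j p = 0 :=
  TwoSidedIdeal.mem_mk' _ _ _ _ _ _ _

lemma block_single_mem_relationIdeal {R : QuadraticRelations V} {i j : V} {p : Path i j}
    (hp : ¬ AvoidsRelations R p) (c : k) :
    block k i j (Finsupp.single p c) ∈ relationIdeal k R := by
  unfold AvoidsRelations at hp
  push Not at hp
  obtain ⟨x, y, z, p₁, a, b, p₂, rfl, hab⟩ := hp
  have h : block k i j (Finsupp.single (((p₁.cons a).cons b).comp p₂) c) =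
      block k i x (Finsupp.single p₁ c) * ofPath k (a.toPath.comp b.toPath) *
        block k z j (Finsupp.single p₂ 1) := by
    change _ = _ * block k x z (Finsupp.single (a.toPath.comp b.toPath) 1) * _
    rw [block_mul_block, block_mul_block, concat_single, concat_single, mul_one, mul_one]
    rfl
  rw [h]
  refine TwoSidedIdeal.mul_mem_right _ _ _ (TwoSidedIdeal.mul_mem_left _ _ _ ?_)
  exact TwoSidedIdeal.subset_span ⟨x, y, z, a, b, hab, rfl⟩

/-- A path containing a relation is the product of the relation with the pieces before and after it.
Conversely, the span of these paths is already an ideal. -/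
lemma relationIdeal_eq (R : QuadraticRelations V) : relationIdeal k R = spanOfRelations k R := by
  refine le_antisymm (TwoSidedIdeal.span_le.2 ?_) fun f hf => ?_
  · rintro _ ⟨x, y, z, a, b, hab, rfl⟩
    refine mem_spanOfRelations.2 fun i j p hp => ?_
    change block k x z (Finsupp.single (a.toPath.comp b.toPath) 1) i j p = 0
    by_cases hi : i = x
    · subst hi
      by_cases hj : j = z
      · subst hj
        rw [block_same, Finsupp.single_eq_of_ne]
        rintro rfl
        exact hp Path.nil a b Path.nil rfl hab
      · rw [block_of_ne_right _ _ hj, Finsupp.zero_apply]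
    · rw [block_of_ne_left _ _ hi, Finsupp.zero_apply]
  · rw [mem_spanOfRelations] at hf
    have key : ∀ i j, block k i j (f i j) ∈ relationIdeal k R := by
      intro i j
      have h : ∀ s : Finset (Path i j), (∀ p ∈ s, ¬ AvoidsRelations R p) →
          block k i j (∑ p ∈ s, Finsupp.single p (f i j p)) ∈ relationIdeal k R := by
        intro s
        induction s using Finset.cons_induction with
        | empty =>
          intro _
          rw [Finset.sum_empty, block_zero]
          exact TwoSidedIdeal.zero_mem _
        | cons p s hp ih =>
          intro hs
          rw [Finset.sum_cons, block_add]
          exact TwoSidedIdeal.add_mem _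
            (block_single_mem_relationIdeal (hs p (Finset.mem_cons_self _ _)) _)
            (ih fun q hq => hs q (Finset.mem_cons_of_mem hq))
      have h' := h (f i j).support fun p hp hp' => Finsupp.mem_support_iff.1 hp (hf p hp')
      rwa [← Finsupp.sum, Finsupp.sum_single] at h'
    rw [← sum_block f]
    exact sum_mem fun i _ => sum_mem fun j _ => key i j

namespace BoundAlgebra

variable {R : QuadraticRelations V}

variable (k R) in
/-- The projection from the path algebra. -/
abbrev proj : PathAlgebra k V →+* BoundAlgebra k R := (relationIdeal k R).ringCon.mk'

lemma proj_surjective : Function.Surjective (proj k R) := RingCon.mk'_surjective _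

/-- The working description of the quotient: only coefficients of paths avoiding relations matter.
-/
lemma proj_eq_proj_iff {f g : PathAlgebra k V} :
    proj k R f = proj k R g ↔
      ∀ ⦃i j : V⦄ (p : Path i j), AvoidsRelations R p → f i j p = g i j p := by
  have h : proj k R f = proj k R g ↔ f - g ∈ relationIdeal k R := by
    rw [← TwoSidedIdeal.rel_iff]
    exact RingCon.eq _
  rw [h, relationIdeal_eq, mem_spanOfRelations]
  exact forall_congr' fun i => forall_congr' fun j => forall₂_congr fun p _ => sub_eq_zero

variable (k R) in
/-- The coefficient of the idempotent of the vertex `i`. -/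
def aug (i : V) : BoundAlgebra k R →+* k :=
  RingCon.lift _ (nilCoeff i) fun _ _ h =>
    proj_eq_proj_iff.1 ((RingCon.eq _).2 h) Path.nil (avoidsRelations_nil i)

lemma aug_proj (i : V) (f : PathAlgebra k V) : aug k R i (proj k R f) = f i i Path.nil := rfl

lemma vertexIdempotent_mul_of_ne {i j : V} (h : i ≠ j) :
    vertexIdempotent k R i * vertexIdempotent k R j = 0 := by
  rw [vertexIdempotent, vertexIdempotent, ← map_mul]
  refine (congrArg _ ?_).trans (map_zero (proj k R))
  funext x y
  rw [ofPath_nil_mul_apply, PathAlgebra.zero_apply]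
  split_ifs with hx
  · exact block_of_ne_left _ _ (hx ▸ h)
  · rfl

/-- An element killed by all characters is represented without paths of length zero, and lengths add
under multiplication. Beyond the bound on paths avoiding relations, such products vanish. -/
lemma exists_isDeep (l : List (BoundAlgebra k R)) (hl : ∀ x ∈ l, ∀ i, aug k R i x = 0) :
    ∃ f : PathAlgebra k V, proj k R f = l.prod ∧ IsDeep l.length f := by
  induction l with
  | nil => exact ⟨1, map_one _, fun i j p hp => absurd hp (Nat.not_lt_zero _)⟩
  | cons a l ih =>
    obtain ⟨g, hg, hg'⟩ := ih fun x hx => hl x (List.mem_cons_of_mem _ hx)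
    obtain ⟨f, rfl⟩ := proj_surjective a
    refine ⟨f * g, by rw [map_mul, hg, List.prod_cons], ?_⟩
    rw [List.length_cons, add_comm]
    refine IsDeep.mul (fun i j p hp => ?_) hg'
    rw [Nat.lt_one_iff] at hp
    obtain rfl := Path.eq_of_length_zero p hp
    obtain rfl := Path.eq_nil_of_length_zero p hp
    exact hl _ List.mem_cons_self i

variable (k) in
/-- The vertices of a quiver with relations, as a system of vertices of its algebra. -/
def vertexSystem (h : ∃ N : ℕ, ∀ ⦃i j : V⦄ (p : Path i j), AvoidsRelations R p → p.length < N) :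
    VertexSystem (BoundAlgebra k R) k V where
  e := vertexIdempotent k R
  isIdempotentElem_e := isIdempotentElem_vertexIdempotent k R
  aug := aug k R
  aug_self i := by
    change block k i i (Finsupp.single Path.nil 1) i i Path.nil = 1
    rw [block_same, Finsupp.single_eq_same]
  aug_ne i j hij := by
    change block k j j (Finsupp.single Path.nil 1) i i Path.nil = 0
    rw [block_of_ne_left _ _ hij.symm, Finsupp.zero_apply]
  aug_surjective i c := by
    refine ⟨proj k R (block k i i (Finsupp.single Path.nil c)), ?_⟩
    rw [aug_proj, block_same, Finsupp.single_eq_same]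
  nilpotent := by
    obtain ⟨N, hN⟩ := h
    refine ⟨N, fun l hl hl' => ?_⟩
    obtain ⟨f, hf, hf'⟩ := exists_isDeep l hl'
    rw [← hf, ← map_zero (proj k R), proj_eq_proj_iff]
    intro i j p hp
    exact hf' p (hl ▸ hN p hp)

end BoundAlgebra

end PathAlgebra

/-! ### The algebra of the shortcut quiver -/

section Shortcut

variable {k : Type u} [Field k] {V : Type u} [Quiver.{u} V] [DecidableEq V]
  {R : QuadraticRelations V} {J : Finset V}

open Quiver PathAlgebra BoundAlgebra

/-- The linear extension of `flatten`. -/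
def flattenAlgebra (f : PathAlgebra k (Shortcut R J)) : PathAlgebra k V := fun x y =>
  if h : x ∈ J ∧ y ∈ J then
    (f ⟨x, h.1⟩ ⟨y, h.2⟩).mapDomain (flatten (i := ⟨x, h.1⟩) (j := ⟨y, h.2⟩))
  else 0

lemma flattenAlgebra_apply (f : PathAlgebra k (Shortcut R J)) (i j : Shortcut R J) :
    flattenAlgebra f i.1 j.1 = (f i j).mapDomain flatten :=
  dif_pos ⟨i.2, j.2⟩

lemma flattenAlgebra_apply_flatten (f : PathAlgebra k (Shortcut R J)) {i j : Shortcut R J}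
    (p : Path i j) : flattenAlgebra f i.1 j.1 (flatten p) = f i j p := by
  rw [flattenAlgebra_apply, Finsupp.mapDomain_apply flatten_injective]

lemma flattenAlgebra_of_not_mem (f : PathAlgebra k (Shortcut R J)) {x y : V}
    (h : ¬ (x ∈ J ∧ y ∈ J)) : flattenAlgebra f x y = 0 :=
  dif_neg h

variable [Fintype V]

lemma flattenAlgebra_add (f g : PathAlgebra k (Shortcut R J)) :
    flattenAlgebra (f + g) = flattenAlgebra f + flattenAlgebra g := by
  funext x y
  rw [PathAlgebra.add_apply]
  by_cases h : x ∈ J ∧ y ∈ J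
  · obtain ⟨i, rfl⟩ : ∃ i : Shortcut R J, i.1 = x := ⟨⟨x, h.1⟩, rfl⟩
    obtain ⟨j, rfl⟩ : ∃ j : Shortcut R J, j.1 = y := ⟨⟨y, h.2⟩, rfl⟩
    rw [flattenAlgebra_apply, flattenAlgebra_apply, flattenAlgebra_apply, PathAlgebra.add_apply,
      Finsupp.mapDomain_add]
  · simp only [flattenAlgebra_of_not_mem _ h, add_zero]

/-- Flattened elements vanish outside `J`, so the sum over middle vertices in `V` reduces to a sum
over `J`. -/
lemma flattenAlgebra_mul (f g : PathAlgebra k (Shortcut R J)) :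
    flattenAlgebra (f * g) = flattenAlgebra f * flattenAlgebra g := by
  funext x y
  rw [PathAlgebra.mul_apply]
  by_cases h : x ∈ J ∧ y ∈ J
  · obtain ⟨i, rfl⟩ : ∃ i : Shortcut R J, i.1 = x := ⟨⟨x, h.1⟩, rfl⟩
    obtain ⟨j, rfl⟩ : ∃ j : Shortcut R J, j.1 = y := ⟨⟨y, h.2⟩, rfl⟩
    rw [flattenAlgebra_apply, PathAlgebra.mul_apply, Finsupp.mapDomain_finsetSum,
      ← Finset.sum_subset (Finset.subset_univ J)]
    · have hl (l : Shortcut R J) : (concat k i l j (f i l) (g l j)).mapDomain flatten =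
          concat k i.1 l.1 j.1 (flattenAlgebra f i.1 l.1) (flattenAlgebra g l.1 j.1) := by
        rw [flattenAlgebra_apply f i l, flattenAlgebra_apply g l j, concat_mapDomain_flatten]
      exact (Fintype.sum_congr _ _ hl).trans (Finset.sum_coe_sort J fun l =>
        concat k i.1 l j.1 (flattenAlgebra f i.1 l) (flattenAlgebra g l j.1))
    · intro l _ hl
      rw [flattenAlgebra_of_not_mem f fun h => hl h.2, map_zero, LinearMap.zero_apply]
  · rw [flattenAlgebra_of_not_mem _ h]
    symm
    refine Finset.sum_eq_zero fun l _ => ?_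
    by_cases hx : x ∈ J
    · rw [flattenAlgebra_of_not_mem g fun h' => h ⟨hx, h'.2⟩, map_zero]
    · rw [flattenAlgebra_of_not_mem f fun h' => hx h'.1, map_zero, LinearMap.zero_apply]

/-- Flattening is a bijection onto the paths avoiding relations with ends in `J`. One direction
makes the map on quotients well defined, the other makes it injective. -/
lemma proj_flattenAlgebra_eq_iff {f g : PathAlgebra k (Shortcut R J)} :
    proj k R (flattenAlgebra f) = proj k R (flattenAlgebra g) ↔
      proj k (shortcutRelations R J) f = proj k (shortcutRelations R J) g := by
  rw [proj_eq_proj_iff, proj_eq_proj_iff]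
  constructor
  · intro h i j p hp
    have := h (flatten p) ((avoidsRelations_flatten_iff p).2 hp)
    rwa [flattenAlgebra_apply_flatten, flattenAlgebra_apply_flatten] at this
  · intro h x y p hp
    by_cases hxy : x ∈ J ∧ y ∈ J
    · obtain ⟨i, rfl⟩ : ∃ i : Shortcut R J, i.1 = x := ⟨⟨x, hxy.1⟩, rfl⟩
      obtain ⟨j, rfl⟩ : ∃ j : Shortcut R J, j.1 = y := ⟨⟨y, hxy.2⟩, rfl⟩
      obtain ⟨q, rfl⟩ := exists_flatten_eq p hp
      rw [flattenAlgebra_apply_flatten, flattenAlgebra_apply_flatten]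
      exact h q ((avoidsRelations_flatten_iff q).1 hp)
    · rw [flattenAlgebra_of_not_mem f hxy, flattenAlgebra_of_not_mem g hxy]

/-- Flattening sends `1` to the sum of the idempotents of `J`, so it is not unital. The map on
quotients is defined through an arbitrary section, and this is its independence of the choice. -/
lemma proj_flattenAlgebra_surjInv (f : PathAlgebra k (Shortcut R J)) :
    proj k R (flattenAlgebra (Function.surjInv proj_surjective
      (proj k (shortcutRelations R J) f))) = proj k R (flattenAlgebra f) :=
  proj_flattenAlgebra_eq_iff.2 (Function.surjInv_eq proj_surjective _)

variable (k R J) in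
/-- The embedding of the algebra of the shortcut quiver. -/
def shortcutHom : BoundAlgebra k (shortcutRelations R J) →ₙ+* BoundAlgebra k R where
  toFun b := proj k R (flattenAlgebra (Function.surjInv proj_surjective b))
  map_zero' := by
    rw [← map_zero (proj k (shortcutRelations R J)), proj_flattenAlgebra_surjInv]
    refine (congrArg _ ?_).trans (map_zero (proj k R))
    simpa using flattenAlgebra_add (0 : PathAlgebra k (Shortcut R J)) 0
  map_add' b c := by
    obtain ⟨f, rfl⟩ := proj_surjective b
    obtain ⟨g, rfl⟩ := proj_surjective c
    rw [← map_add, proj_flattenAlgebra_surjInv, proj_flattenAlgebra_surjInv,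
      proj_flattenAlgebra_surjInv, flattenAlgebra_add, map_add]
  map_mul' b c := by
    obtain ⟨f, rfl⟩ := proj_surjective b
    obtain ⟨g, rfl⟩ := proj_surjective c
    rw [← map_mul, proj_flattenAlgebra_surjInv, proj_flattenAlgebra_surjInv,
      proj_flattenAlgebra_surjInv, flattenAlgebra_mul, map_mul]

lemma shortcutHom_proj (f : PathAlgebra k (Shortcut R J)) :
    shortcutHom k R J (proj k (shortcutRelations R J) f) = proj k R (flattenAlgebra f) :=
  proj_flattenAlgebra_surjInv f

lemma shortcutHom_injective : Function.Injective (shortcutHom k R J) := by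
  intro b c h
  obtain ⟨f, rfl⟩ := proj_surjective b
  obtain ⟨g, rfl⟩ := proj_surjective c
  rw [shortcutHom_proj, shortcutHom_proj] at h
  exact proj_flattenAlgebra_eq_iff.1 h

lemma sum_vertexIdempotent_mul_eq_iff (f : PathAlgebra k V) :
    (∑ j ∈ J, vertexIdempotent k R j) * proj k R f = proj k R f ↔
      ∀ ⦃x y : V⦄ (p : Path x y), AvoidsRelations R p → x ∉ J → f x y p = 0 := by
  have h : (∑ j ∈ J, vertexIdempotent k R j) * proj k R f =
      proj k R (∑ j ∈ J, ofPath k (Path.nil : Path j j) * f) := by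
    rw [Finset.sum_mul, map_sum]
    exact Finset.sum_congr rfl fun j _ => (map_mul _ _ _).symm
  rw [h, proj_eq_proj_iff]
  refine forall_congr' fun x => forall_congr' fun y => forall₂_congr fun p hp => ?_
  simp only [PathAlgebra.sum_apply, ofPath_nil_mul_apply, Finset.sum_ite_eq]
  split_ifs with hx
  · simp [hx]
  · simp [hx, eq_comm]

lemma mul_sum_vertexIdempotent_eq_iff (f : PathAlgebra k V) :
    proj k R f * (∑ j ∈ J, vertexIdempotent k R j) = proj k R f ↔
      ∀ ⦃x y : V⦄ (p : Path x y), AvoidsRelations R p → y ∉ J → f x y p = 0 := by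
  have h : proj k R f * (∑ j ∈ J, vertexIdempotent k R j) =
      proj k R (∑ j ∈ J, f * ofPath k (Path.nil : Path j j)) := by
    rw [Finset.mul_sum, map_sum]
    exact Finset.sum_congr rfl fun j _ => (map_mul _ _ _).symm
  rw [h, proj_eq_proj_iff]
  refine forall_congr' fun x => forall_congr' fun y => forall₂_congr fun p hp => ?_
  simp only [PathAlgebra.sum_apply, mul_ofPath_nil_apply, Finset.sum_ite_eq]
  split_ifs with hy
  · simp [hy]
  · simp [hy, eq_comm]

/-- The range is `eΛe`: the two equations confine the support, modulo relations, to paths with both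
ends in `J`, and those avoiding relations are all flattened paths. -/
lemma exists_shortcutHom_eq_iff (a : BoundAlgebra k R) :
    (∃ b, shortcutHom k R J b = a) ↔
      (∑ j ∈ J, vertexIdempotent k R j) * a = a ∧ a * (∑ j ∈ J, vertexIdempotent k R j) = a := by
  constructor
  · rintro ⟨b, rfl⟩
    obtain ⟨f, rfl⟩ := proj_surjective b
    rw [shortcutHom_proj, sum_vertexIdempotent_mul_eq_iff, mul_sum_vertexIdempotent_eq_iff]
    constructor
    · intro x y p _ hx
      rw [flattenAlgebra_of_not_mem f fun h => hx h.1, Finsupp.zero_apply]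
    · intro x y p _ hy
      rw [flattenAlgebra_of_not_mem f fun h => hy h.2, Finsupp.zero_apply]
  · obtain ⟨f, rfl⟩ := proj_surjective a
    rw [sum_vertexIdempotent_mul_eq_iff, mul_sum_vertexIdempotent_eq_iff]
    rintro ⟨hx, hy⟩
    let g : PathAlgebra k (Shortcut R J) := fun i j =>
      (f i.1 j.1).comapDomain flatten flatten_injective.injOn
    refine ⟨proj k _ g, ?_⟩
    rw [shortcutHom_proj, proj_eq_proj_iff]
    intro x y p hp
    by_cases hxy : x ∈ J ∧ y ∈ J
    · obtain ⟨i, rfl⟩ : ∃ i : Shortcut R J, i.1 = x := ⟨⟨x, hxy.1⟩, rfl⟩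
      obtain ⟨j, rfl⟩ : ∃ j : Shortcut R J, j.1 = y := ⟨⟨y, hxy.2⟩, rfl⟩
      obtain ⟨q, rfl⟩ := exists_flatten_eq p hp
      rw [flattenAlgebra_apply_flatten]
      rfl
    · rw [flattenAlgebra_of_not_mem g hxy, Finsupp.zero_apply]
      rcases not_and_or.1 hxy with h | h
      · exact (hx p hp h).symm
      · exact (hy p hp h).symm

lemma isIdempotentElem_sum_vertexIdempotent (J : Finset V) :
    IsIdempotentElem (∑ j ∈ J, vertexIdempotent k R j) := by
  rw [IsIdempotentElem, Finset.sum_mul]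
  refine Finset.sum_congr rfl fun i hi => ?_
  rw [Finset.mul_sum, Finset.sum_eq_single i]
  · exact isIdempotentElem_vertexIdempotent k R i
  · exact fun j _ hj => vertexIdempotent_mul_of_ne hj.symm
  · exact fun h => (h hi).elim

end Shortcut

end GentleSilting

end

/-- For a gentle quiver with relations and any subset `J` of its vertices, the 2-term silting
complex of the shortcut quiver at `J` is isomorphic to the subcomplex of the 2-term silting complex
of the given quiver which is induced by the indecomposable rigid 2-term objects whose g-vectors lie
in the coordinate subspace spanned by `J`. -/
theorem theorem4p5 (k : Type u) [Field k] {V : Type u} [Fintype V] [DecidableEq V]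
    [Quiver.{u} V] (R : GentleSilting.QuadraticRelations V) (hR : GentleSilting.IsGentle R)
    (J : Finset V) :
    GentleSilting.AreIsomorphic
      (GentleSilting.siltingComplex
        (GentleSilting.BoundAlgebra k (GentleSilting.shortcutRelations R J)))
      (GentleSilting.inducedSubcomplex
        (GentleSilting.siltingComplex (GentleSilting.BoundAlgebra k R))
        {v | v.gVector ∈ GentleSilting.coordinateSubspace (GentleSilting.vertexIdempotent k R)
          (GentleSilting.isIdempotentElem_vertexIdempotent k R) J}) := by
  open GentleSilting in
  let S := BoundAlgebra.vertexSystem k hR.admissible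
  have he := isIdempotentElem_sum_vertexIdempotent (k := k) (R := R) J
  -- The shortcut algebra, embedded as `eΛe`, is identified with the endomorphism ring of `eΛ`.
  obtain ⟨σ⟩ := exists_equiv_end he (shortcutHom k R J) shortcutHom_injective
    exists_shortcutHom_eq_iff
  obtain ⟨F, hFull, hFaithful, hAdd, hF⟩ := exists_fullyFaithful_of_end_equiv σ
  refine areIsomorphic_of_essImage_eq (S := S) (F := F) fun P => ?_
  rw [hF]
  exact addClosure_idempotentProj_iff S (fun i j h => BoundAlgebra.vertexIdempotent_mul_of_ne h) he P
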